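/- **Conventions.** For a C$^*$-algebra $\mathcal A$ let $\mathcal A^\sim$ denote its unitization: $\mathcal A^\sim=\mathbb C\oplus\mathcal A$; if $\mathcal A$ is unital one may also take $\mathcal A^\sim=\mathcal A$, and the statement below holds for both choices. $K_0(\mathcal A)$ is the Grothendieck group of homotopy classes of projections in matrix algebras over $\mathcal A$ if $\mathcal A$ is unital, and in general the kernel of $K_0(\mathbb C\oplus\mathcal A)\to K_0(\mathbb C)$; $K_1(\mathcal A)$ is the group of stable homotopy classes of invertibles in matrix algebras over $\mathcal A^\sim$. A selfadjoint invertible $h\in M_n(\mathcal A^\sim)$ with positive spectral projection $p=\chi(h>0)$ defines $[h]_0=[p]-[s(p)]\in K_0(\mathcal A)$, where $s(p)$ is the scalar part of $p$ when $\mathcal A^\sim=\mathbb C\oplus\mathcal A$ (if $\mathcal A^\sim=\mathcal A$ is unital, $[h]_0=[p]$). If $h$ moreover anticommutes with ${\bf 1}\otimes\Gamma$ for a symmetry $\Gamma=\Gamma^*=\Gamma^{-1}\in M_n(\mathbb C)$, then in an orthonormal eigenbasis of $\Gamma$ with $\Gamma=\mathrm{diag}(1,-1)$ one has $h=\begin{pmatrix}0&x\\x^*&0\end{pmatrix}$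 with $x$ invertible, and $[h]_1=[x]\in K_1(\mathcal A)$. Invertible $A_1,\dots,A_d\in\mathcal A^\sim$ form a *fuzzy $d$-torus of width $\delta\in[0,1)$* if $\|A_jA_j^*-{\bf 1}\|\le\delta$, $\|A_j^*A_j-{\bf 1}\|\le\delta$ and $\|[A_j,A_i]\|\le\delta$ for all $i,j$. A fuzzy $(d+1)$-torus $A_1,\dots,A_{d+1}$ of width $\delta$ with $A_{d+1}=A_{d+1}^*$ is a *graded fuzzy $d$-torus of width $\delta$*. For $I=\{i_1<\dots<i_{|I|}\}\subset\{1,\dots,d\}$ and an irreducible selfadjoint representation $\gamma_1,\dots,\gamma_{|I|+1}$ on $\mathbb C^n$ of the Clifford algebra with $|I|+1$ generators put $$G_I=\sum_{j=1}^{|I|}\Im m(A_{i_j})\otimes\gamma_j+\Big((|I|-1){\bf 1}-\sum_{j=1}^{|I|}\Re e(A_{i_j})\Big)\otimes\gamma_{|I|+1},$$ $$\widehat G_I=\sum_{j=1}^{|I|}\Im m(A_{i_j})\otimes\gamma_j+\Big(|I|{\bf 1}-\sum_{j=1}^{|I|}\Re e(A_{i_j})-A_{d+1}\Big)\otimes\gamma_{|I|+1}.$$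 For a graded torus let $P$ be the Riesz projection of $A_{d+1}$ on its positive spectrum, and let $G^P_I$ be the operator $G_I$ of $PA_1P,\dots,PA_dP$ in $P\mathcal A^\sim P$ (with unit $P$). **Corollary.** For every $d$ there is $\delta_0>0$, depending only on $d$, such that for every $\delta\le\delta_0$, every C$^*$-algebra $\mathcal A$, every $I\subset\{1,\dots,d\}$ and every irreducible selfadjoint representation $\gamma$ as above the following hold. 1. Let $A_1,\dots,A_d\in\mathcal A^\sim$ be a fuzzy $d$-torus of width $\delta$. If $|I|$ is even, then $G_I$ is selfadjoint and invertible and hence defines a unique class $[G_I]_0\in K_0(\mathcal A)$. If $|I|$ is odd, then there is a further Clifford generator $\Gamma$ on $\mathbb C^n$, that is, a selfadjoint unitary anticommuting with all $\gamma_j$, and for each such $\Gamma$ the operator $G_I$ is selfadjoint, invertible and anticommutes with ${\bf 1}\otimes\Gamma$, and hence defines a class $[G_I]_1\in K_1(\mathcal A)$ that does not depend on the choice of the eigenbasis of $\Gamma$. 2. Let $A_1,\dots,A_{d+1}\in\mathcal A^\sim$ be a graded fuzzy $d$-torus of width $\delta$. In the same sense $\widehat G_I$ defines a class $[\widehat G_I]_0\in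 K_0(\mathcal A)$ if $|I|$ is even and $[\widehat G_I]_1\in K_1(\mathcal A)$ if $|I|$ is odd. Moreover, $P$ is a projection, $PA_1P,\dots,PA_dP$ is a fuzzy $d$-torus of width $6\delta$ in $P\mathcal A^\sim P$, and these classes are also represented by the operators $G^P_I$, completed by $({\bf 1}-P)\otimes\gamma_{|I|+1}$ on the complement of $P$: $$[\widehat G_I]_0=[G^P_I\oplus({\bf 1}-P)\otimes\gamma_{|I|+1}]_0\ \ (|I|\text{ even}),\qquad[\widehat G_I]_1=[G^P_I\oplus({\bf 1}-P)\otimes\gamma_{|I|+1}]_1\ \ (|I|\text{ odd}).$$ -/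

import Mathlib

universe u

noncomputable section

open scoped Matrix

namespace FuzzyTorus

/-! ## Spectral projections and matrices over a unital C⋆-algebra -/

section Spectral

attribute [local instance] CStarAlgebra.spectralOrder CStarAlgebra.spectralOrderedRing

/-- The spectral projection `χ(h > 0)`, obtained by continuous functional calculus.  It is used
only for selfadjoint invertible `h`, where `χ(· > 0)` is continuous on the spectrum; it is then
the Riesz projection of `h` on its positive spectrum. -/
def posProj {B : Type*} [CStarAlgebra B] (h : B) : B :=
  cfc (Set.indicator (Set.Ioi (0 : ℝ)) (fun _ => (1 : ℝ))) h

/-- `χ(h > 0)` for a matrix `h` over a C⋆-algebra. -/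
def matPosProj {E : Type*} [CStarAlgebra E] {n : ℕ} (h : CStarMatrix (Fin n) (Fin n) E) :
    CStarMatrix (Fin n) (Fin n) E :=
  posProj h

end Spectral

section Matrices

variable {E : Type*} [CStarAlgebra E]

/-- The block sum `diag(a, b)` of two square matrices over `E`. -/
def dsum {m n : ℕ} (a : CStarMatrix (Fin m) (Fin m) E) (b : CStarMatrix (Fin n) (Fin n) E) :
    CStarMatrix (Fin (m + n)) (Fin (m + n)) E :=
  CStarMatrix.ofMatrix
    ((Matrix.fromBlocks (CStarMatrix.ofMatrix.symm a) 0 0 (CStarMatrix.ofMatrix.symm b)).submatrix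
      finSumFinEquiv.symm finSumFinEquiv.symm)

/-- A complex matrix viewed as a matrix over `E`. -/
def scal (E : Type*) [CStarAlgebra E] {m n : ℕ} (M : Matrix (Fin m) (Fin n) ℂ) :
    CStarMatrix (Fin m) (Fin n) E :=
  CStarMatrix.ofMatrix (M.map (algebraMap ℂ E))

/-- The elementary tensor `a ⊗ γ` in `E ⊗ Mₙ(ℂ) = Mₙ(E)`. -/
def tens {n : ℕ} (a : E) (γ : Matrix (Fin n) (Fin n) ℂ) : CStarMatrix (Fin n) (Fin n) E :=
  CStarMatrix.ofMatrix (γ.map fun z => z • a)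

end Matrices

/-! ## K-theory of C⋆-algebras -/

section KTheory

/-- Projections in the matrix algebras `Mₙ(E)`, `n ∈ ℕ`. -/
abbrev MatProj (E : Type*) [CStarAlgebra E] : Type _ :=
  Σ n : ℕ, {p : CStarMatrix (Fin n) (Fin n) E // IsStarProjection p}

/-- Invertibles in the matrix algebras `Mₙ(E)`, `n ∈ ℕ`. -/
abbrev MatInv (E : Type*) [CStarAlgebra E] : Type _ :=
  Σ n : ℕ, {x : CStarMatrix (Fin n) (Fin n) E // IsUnit x}

/-- Defining relations of `K₀` of a unital C⋆-algebra: block sums are sums, homotopic projections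
are equal, zero projections vanish. -/
inductive K0Rel (E : Type*) [CStarAlgebra E] : FreeAbelianGroup (MatProj E) → Prop
  | sum {m n : ℕ} (p : {p : CStarMatrix (Fin m) (Fin m) E // IsStarProjection p})
      (q : {p : CStarMatrix (Fin n) (Fin n) E // IsStarProjection p})
      (r : {p : CStarMatrix (Fin (m + n)) (Fin (m + n)) E // IsStarProjection p})
      (h : r.1 = dsum p.1 q.1) :
      K0Rel E (FreeAbelianGroup.of ⟨m + n, r⟩ - FreeAbelianGroup.of ⟨m, p⟩
        - FreeAbelianGroup.of ⟨n, q⟩)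
  | homotopy {n : ℕ} (p q : {p : CStarMatrix (Fin n) (Fin n) E // IsStarProjection p})
      (h : JoinedIn {x : CStarMatrix (Fin n) (Fin n) E | IsStarProjection x} p.1 q.1) :
      K0Rel E (FreeAbelianGroup.of ⟨n, p⟩ - FreeAbelianGroup.of ⟨n, q⟩)
  | zero {n : ℕ} (p : {p : CStarMatrix (Fin n) (Fin n) E // IsStarProjection p}) (h : p.1 = 0) :
      K0Rel E (FreeAbelianGroup.of ⟨n, p⟩)

/-- `K₀(E)` of a unital C⋆-algebra `E`: the Grothendieck group of homotopy classes of projections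
in matrix algebras over `E`, by generators and relations. -/
abbrev K0Unital (E : Type*) [CStarAlgebra E] : Type _ :=
  FreeAbelianGroup (MatProj E) ⧸ AddSubgroup.closure {x | K0Rel E x}

/-- The class of a projection in `K₀(E)`. -/
def K0Unital.mk {E : Type*} [CStarAlgebra E] {n : ℕ} (p : CStarMatrix (Fin n) (Fin n) E)
    (hp : IsStarProjection p) : K0Unital E :=
  QuotientAddGroup.mk (FreeAbelianGroup.of (⟨n, p, hp⟩ : MatProj E))

/-- Defining relations of `K₁` of a unital C⋆-algebra: block sums are sums, homotopic invertibles
are equal, identity matrices vanish. -/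
inductive K1Rel (E : Type*) [CStarAlgebra E] : FreeAbelianGroup (MatInv E) → Prop
  | sum {m n : ℕ} (p : {p : CStarMatrix (Fin m) (Fin m) E // IsUnit p})
      (q : {p : CStarMatrix (Fin n) (Fin n) E // IsUnit p})
      (r : {p : CStarMatrix (Fin (m + n)) (Fin (m + n)) E // IsUnit p})
      (h : r.1 = dsum p.1 q.1) :
      K1Rel E (FreeAbelianGroup.of ⟨m + n, r⟩ - FreeAbelianGroup.of ⟨m, p⟩
        - FreeAbelianGroup.of ⟨n, q⟩)
  | homotopy {n : ℕ} (p q : {p : CStarMatrix (Fin n) (Fin n) E // IsUnit p})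
      (h : JoinedIn {x : CStarMatrix (Fin n) (Fin n) E | IsUnit x} p.1 q.1) :
      K1Rel E (FreeAbelianGroup.of ⟨n, p⟩ - FreeAbelianGroup.of ⟨n, q⟩)
  | one {n : ℕ} (p : {p : CStarMatrix (Fin n) (Fin n) E // IsUnit p}) (h : p.1 = 1) :
      K1Rel E (FreeAbelianGroup.of ⟨n, p⟩)

/-- `K₁(E)` of a unital C⋆-algebra `E`: stable homotopy classes of invertibles in matrix algebras
over `E`, by generators and relations. -/
abbrev K1Unital (E : Type*) [CStarAlgebra E] : Type _ :=
  FreeAbelianGroup (MatInv E) ⧸ AddSubgroup.closure {x | K1Rel E x}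

/-- The class of an invertible matrix in `K₁(E)`. -/
def K1Unital.mk {E : Type*} [CStarAlgebra E] {n : ℕ} (x : CStarMatrix (Fin n) (Fin n) E)
    (hx : IsUnit x) : K1Unital E :=
  QuotientAddGroup.mk (FreeAbelianGroup.of (⟨n, x, hx⟩ : MatInv E))

variable {E F : Type*} [CStarAlgebra E] [CStarAlgebra F]

theorem map_dsum (φ : E →⋆ₐ[ℂ] F) {m n : ℕ} (a : CStarMatrix (Fin m) (Fin m) E)
    (b : CStarMatrix (Fin n) (Fin n) E) : (dsum a b).map φ = dsum (a.map φ) (b.map φ) := by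
  ext i j
  refine Fin.addCases (fun i => ?_) (fun i => ?_) i <;>
    refine Fin.addCases (fun j => ?_) (fun j => ?_) j <;>
    simp [dsum, CStarMatrix.ofMatrix_apply]

theorem map_isStarProjection (φ : E →⋆ₐ[ℂ] F) {n : ℕ} {p : CStarMatrix (Fin n) (Fin n) E}
    (hp : IsStarProjection p) : IsStarProjection (p.map φ) := by
  refine ⟨?_, ?_⟩
  · have h := hp.isIdempotentElem
    rw [IsIdempotentElem] at h ⊢
    ext i j
    rw [CStarMatrix.mul_apply]
    conv_rhs => rw [← h]
    simp [CStarMatrix.mul_apply]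
  · have h := hp.isSelfAdjoint
    rw [isSelfAdjoint_iff] at h ⊢
    ext i j
    conv_rhs => rw [← h]
    simp [CStarMatrix.star_apply, map_star]

theorem continuous_map (φ : E →⋆ₐ[ℂ] F) (n : ℕ) :
    Continuous (fun p : CStarMatrix (Fin n) (Fin n) E => p.map φ) :=
  Continuous.matrix_map (A := fun p : Matrix (Fin n) (Fin n) E => p) continuous_id
    (AddMonoidHomClass.continuous_of_bound φ 1 fun a => by
      simpa using NonUnitalStarAlgHom.norm_apply_le φ a)

/-- The image of a matrix projection under a unital ⋆-homomorphism. -/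
def MatProj.map (φ : E →⋆ₐ[ℂ] F) (x : MatProj E) : MatProj F :=
  ⟨x.1, x.2.1.map φ, map_isStarProjection φ x.2.2⟩

theorem K0Rel.map (φ : E →⋆ₐ[ℂ] F) {x : FreeAbelianGroup (MatProj E)} (hx : K0Rel E x) :
    K0Rel F (FreeAbelianGroup.map (MatProj.map φ) x) := by
  cases hx with
  | @sum m n p q r h =>
    simp only [map_sub, FreeAbelianGroup.map_of_apply]
    exact K0Rel.sum ⟨p.1.map φ, map_isStarProjection φ p.2⟩
      ⟨q.1.map φ, map_isStarProjection φ q.2⟩ ⟨r.1.map φ, map_isStarProjection φ r.2⟩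
      (by simp only [h, map_dsum])
  | @homotopy n p q h =>
    simp only [map_sub, FreeAbelianGroup.map_of_apply]
    refine K0Rel.homotopy ⟨p.1.map φ, map_isStarProjection φ p.2⟩
      ⟨q.1.map φ, map_isStarProjection φ q.2⟩ ?_
    obtain ⟨γ, hγ⟩ := h
    exact ⟨γ.map (continuous_map φ n), fun t => map_isStarProjection φ (hγ t)⟩
  | @zero n p h =>
    simp only [FreeAbelianGroup.map_of_apply]
    refine K0Rel.zero ⟨p.1.map φ, map_isStarProjection φ p.2⟩ ?_
    ext i j
    simp [h]

/-- The map `K₀(E) → K₀(F)` induced by a unital ⋆-homomorphism. -/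
def K0Unital.map (φ : E →⋆ₐ[ℂ] F) : K0Unital E →+ K0Unital F :=
  QuotientAddGroup.map _ _ (FreeAbelianGroup.map (MatProj.map φ)) <| by
    rw [AddSubgroup.closure_le]
    intro x hx
    exact AddSubgroup.subset_closure (K0Rel.map φ hx)

/-- The scalar part `A^∼ → ℂ` of the unitization `A^∼ = ℂ ⊕ A`. -/
def scalarHom (A : Type*) [NonUnitalCStarAlgebra A] : Unitization ℂ A →⋆ₐ[ℂ] ℂ :=
  { Unitization.fstHom ℂ A with map_star' := fun _ => rfl }

/-- `K₀(A)` of a (possibly non-unital) C⋆-algebra: the kernel of `K₀(A^∼) → K₀(ℂ)`. -/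
abbrev K0 (A : Type*) [NonUnitalCStarAlgebra A] : Type _ :=
  (K0Unital.map (scalarHom A)).ker

/-- `K₁(A)` of a (possibly non-unital) C⋆-algebra: `K₁(A^∼)`. -/
abbrev K1 (A : Type*) [NonUnitalCStarAlgebra A] : Type _ :=
  K1Unital (Unitization ℂ A)

/-- The matrix of scalar parts of a matrix over `A^∼`, viewed again as a matrix over `A^∼`. -/
def scalarPart {A : Type*} [NonUnitalCStarAlgebra A] {n : ℕ}
    (h : CStarMatrix (Fin n) (Fin n) (Unitization ℂ A)) :
    CStarMatrix (Fin n) (Fin n) (Unitization ℂ A) :=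
  h.map fun x => algebraMap ℂ (Unitization ℂ A) (scalarHom A x)

/-- `κ = [h]₀ ∈ K₀(E)`: `h` is a selfadjoint invertible matrix over the unital C⋆-algebra `E`, and
`κ` is the class of its positive spectral projection. -/
def IsK0UnitalClass {n : ℕ} (h : CStarMatrix (Fin n) (Fin n) E) (κ : K0Unital E) : Prop :=
  IsSelfAdjoint h ∧ IsUnit h ∧
    ∃ hp : IsStarProjection (matPosProj h), κ = K0Unital.mk (matPosProj h) hp

/-- `κ = [h]₀ ∈ K₀(A)`: `h` is a selfadjoint invertible matrix over `A^∼`, and `κ = [p] - [s(p)]`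
with `p = χ(h > 0)` and `s(p) = χ(s(h) > 0)` its scalar part (the standard picture of `K₀`). -/
def IsK0Class {A : Type*} [NonUnitalCStarAlgebra A] {n : ℕ}
    (h : CStarMatrix (Fin n) (Fin n) (Unitization ℂ A)) (κ : K0 A) : Prop :=
  IsSelfAdjoint h ∧ IsUnit h ∧
    ∃ (hp : IsStarProjection (matPosProj h)) (hs : IsStarProjection (scalarPart (matPosProj h))),
      (κ : K0Unital (Unitization ℂ A)) =
        K0Unital.mk (matPosProj h) hp - K0Unital.mk (scalarPart (matPosProj h)) hs

/-- `κ = [h]₁ ∈ K₁(E)` with respect to the symmetry `Γ` in the matrix degrees of freedom: `h` is a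
selfadjoint invertible matrix over `E` that anticommutes with `Γ`; in an orthonormal basis of
eigenvectors of `Γ` (the columns of `S` for the eigenvalue `1`, those of `T` for `-1`), where
`Γ = diag(1, -1)` and `h` is off-diagonal, the upper right entry of `h` is `x`, and `κ = [x]`. -/
def IsK1Class {n : ℕ} (Γ : Matrix (Fin n) (Fin n) ℂ) (h : CStarMatrix (Fin n) (Fin n) E)
    (κ : K1Unital E) : Prop :=
  IsSelfAdjoint h ∧ IsUnit h ∧ scal E Γ * h = -(h * scal E Γ) ∧
    ∃ (m : ℕ) (S T : Matrix (Fin n) (Fin m) ℂ) (hx : IsUnit (scal E Sᴴ * h * scal E T)),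
      Sᴴ * S = 1 ∧ Tᴴ * T = 1 ∧ S * Sᴴ + T * Tᴴ = 1 ∧ S * Sᴴ - T * Tᴴ = Γ ∧
      κ = K1Unital.mk (scal E Sᴴ * h * scal E T) hx

end KTheory

/-! ## Fuzzy tori and their `G`-operators -/

section Tori

variable {E : Type*} [CStarAlgebra E] {d n : ℕ}

/-- `T₁, …, T_d` is a fuzzy `d`-torus of width `δ` in the corner `e E e` (whose unit is the
projection `e`). -/
structure IsFuzzyTorusIn (e : E) (δ : ℝ) (T : Fin d → E) : Prop where
  width_nonneg : 0 ≤ δ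
  width_lt_one : δ < 1
  mem_corner : ∀ j, e * T j * e = T j
  invertible : ∀ j, ∃ R : E, e * R * e = R ∧ T j * R = e ∧ R * T j = e
  norm_mul_star : ∀ j, ‖T j * star (T j) - e‖ ≤ δ
  norm_star_mul : ∀ j, ‖star (T j) * T j - e‖ ≤ δ
  norm_commutator : ∀ j i, ‖T j * T i - T i * T j‖ ≤ δ

/-- `T₁, …, T_d` is a fuzzy `d`-torus of width `δ` in `E`. -/
def IsFuzzyTorus (δ : ℝ) (T : Fin d → E) : Prop :=
  IsFuzzyTorusIn 1 δ T

/-- `T₁, …, T_{d+1}` is a graded fuzzy `d`-torus of width `δ` in `E`. -/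
def IsGradedFuzzyTorus (δ : ℝ) (T : Fin (d + 1) → E) : Prop :=
  IsSelfAdjoint (T (Fin.last d)) ∧ IsFuzzyTorus δ T

/-- An irreducible selfadjoint representation on `ℂⁿ` of the Clifford algebra with `k`
generators. -/
structure IsIrreducibleClifford {k : ℕ} (γ : Fin k → Matrix (Fin n) (Fin n) ℂ) : Prop where
  isHermitian : ∀ i, (γ i).IsHermitian
  sq_eq_one : ∀ i, γ i * γ i = 1
  anticommute : ∀ i j, i ≠ j → γ i * γ j = -(γ j * γ i)
  dim_pos : 0 < n
  irreducible : ∀ W : Submodule ℂ (Fin n → ℂ),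
    (∀ i, ∀ w ∈ W, γ i *ᵥ w ∈ W) → W = ⊥ ∨ W = ⊤

/-- `Γ` is a further Clifford generator on the representation space of `γ`. -/
structure IsFurtherGenerator {k : ℕ} (γ : Fin k → Matrix (Fin n) (Fin n) ℂ)
    (Γ : Matrix (Fin n) (Fin n) ℂ) : Prop where
  isHermitian : Γ.IsHermitian
  sq_eq_one : Γ * Γ = 1
  anticommute : ∀ i, Γ * γ i = -(γ i * Γ)

/-- The operator `G_I(T₁, …, T_d)` of a torus in the corner `e E e`:
`∑_j Im(T_{i_j}) ⊗ γ_j + ((|I| - 1) e - ∑_j Re(T_{i_j})) ⊗ γ_{|I|+1}`, where `i_1 < i_2 < …` are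
the elements of `I`. For `e = 1` this is the `G`-operator of a torus in `E`. -/
def gOp (e : E) (T : Fin d → E) (I : Finset (Fin d))
    (γ : Fin (I.card + 1) → Matrix (Fin n) (Fin n) ℂ) : CStarMatrix (Fin n) (Fin n) E :=
  ∑ j : Fin I.card, tens (imaginaryPart (T (I.orderEmbOfFin rfl j)) : E) (γ j.castSucc) +
    tens (((I.card : ℂ) - 1) • e -
      ∑ j : Fin I.card, (realPart (T (I.orderEmbOfFin rfl j)) : E)) (γ (Fin.last I.card))

/-- The operator `Ĝ_I(T₁, …, T_{d+1})` of a graded torus: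
`∑_j Im(T_{i_j}) ⊗ γ_j + (|I| 1 - ∑_j Re(T_{i_j}) - T_{d+1}) ⊗ γ_{|I|+1}`. -/
def gHatOp (T : Fin (d + 1) → E) (I : Finset (Fin d))
    (γ : Fin (I.card + 1) → Matrix (Fin n) (Fin n) ℂ) : CStarMatrix (Fin n) (Fin n) E :=
  ∑ j : Fin I.card,
      tens (imaginaryPart (T (I.orderEmbOfFin rfl j).castSucc) : E) (γ j.castSucc) +
    tens ((I.card : ℂ) • (1 : E) -
      ∑ j : Fin I.card, (realPart (T (I.orderEmbOfFin rfl j).castSucc) : E) - T (Fin.last d))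
      (γ (Fin.last I.card))

/-- The projection `P` of a graded torus: the Riesz projection of `T_{d+1}` on its positive
spectrum. -/
def gradingProj (T : Fin (d + 1) → E) : E :=
  posProj (T (Fin.last d))

/-- The `P`-restricted torus `P T₁ P, …, P T_d P` of a graded torus. -/
def restrictedTorus (T : Fin (d + 1) → E) : Fin d → E :=
  fun j => gradingProj T * T j.castSucc * gradingProj T

/-- `G^P_I ⊕ (1 - P) ⊗ γ_{|I|+1}`: the `G`-operator `G^P_I = G_I(P T₁ P, …, P T_d P)` of the
restricted torus (in the corner `P E P`), completed by the trivial summand on `1 - P`. -/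
def gRestrictedOp (T : Fin (d + 1) → E) (I : Finset (Fin d))
    (γ : Fin (I.card + 1) → Matrix (Fin n) (Fin n) ℂ) : CStarMatrix (Fin n) (Fin n) E :=
  gOp (gradingProj T) (restrictedTorus T) I γ + tens (1 - gradingProj T) (γ (Fin.last I.card))

end Tori

end FuzzyTorus

end

/-!
`G_I`, `Ĝ_I` and the operators between them are Clifford sums `∑ xⱼ ⊗ γⱼ` with selfadjoint
coefficients, so the square of such an operator is `(∑ xⱼ²) ⊗ 1` up to commutators of the `xⱼ`, and
it is invertible as soon as the `xⱼ` almost commute and `∑ xⱼ²` is bounded below.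

For a graded torus put `S = 2P - 1`. Then `‖A_{d+1} - S‖ ≤ δ`, so `S` almost commutes with every
`A_j`, and up to `O(δ)` one may replace `A_{d+1}` by `S` and `A_j` by its diagonal part
`P A_j P + (1 - P) A_j (1 - P)`. After this replacement the operator
`a Ĝ_I + b (G^P_I ⊕ (1 - P) ⊗ γ_{|I|+1})` with `a + b = 1` has the coefficients `w Im A_{i_j}` and
`w X - S`, where `w = a + b P` and `X = ∑ (1 - Re A_{i_j})`. Since `(Im A)² + (1 - Re A)²` is nearly
`2 (1 - Re A)`, their sum of squares is `1 + 2 w (w - S) X + w² C + O(δ)`, where `C` collects the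
mixed terms of `X²`. Here `X` and `C` are positive up to `O(δ)` and `w (w - S)` is positive, so the
whole segment consists of selfadjoint invertibles which anticommute with each further generator:
it is a homotopy between the two classes. Invertibility of `G_I` is the case `P = 1`.
-/

noncomputable section

open scoped Matrix ComplexStarModule

namespace FuzzyTorus

section RealAndImaginaryParts

variable {E : Type*} [CStarAlgebra E]

theorem norm_lie_realPart_le {η : ℝ} {a b : E} (h : ‖⁅a, b⁆‖ ≤ η) (h' : ‖⁅star a, b⁆‖ ≤ η) :
    ‖⁅(ℜ a : E), b⁆‖ ≤ η := by
  rw [realPart_apply_coe, Ring.lie_def, smul_mul_assoc, mul_smul_comm, ← smul_sub, norm_smul,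
    show (a + star a) * b - b * (a + star a) = ⁅a, b⁆ + ⁅star a, b⁆ by
      simp only [Ring.lie_def]; noncomm_ring]
  norm_num
  linarith [norm_add_le_of_le h h']

theorem norm_lie_imaginaryPart_le {η : ℝ} {a b : E} (h : ‖⁅a, b⁆‖ ≤ η)
    (h' : ‖⁅star a, b⁆‖ ≤ η) : ‖⁅(ℑ a : E), b⁆‖ ≤ η := by
  rw [imaginaryPart_apply_coe, Ring.lie_def]
  simp only [smul_mul_assoc, mul_smul_comm, ← smul_sub, norm_smul]
  rw [show (a - star a) * b - b * (a - star a) = ⁅a, b⁆ - ⁅star a, b⁆ by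
    simp only [Ring.lie_def]; noncomm_ring]
  norm_num
  linarith [norm_sub_le_of_le h h']

theorem imaginaryPart_mul_self_add_one_sub_realPart_mul_self (a : E) :
    (ℑ a : E) * ℑ a + (1 - ℜ a) * (1 - ℜ a) =
      (2 : ℝ) • (1 - ℜ a : E) + (2⁻¹ : ℝ) • ((star a * a - 1) + (a * star a - 1)) := by
  have h := star_mul_self_add_self_mul_star a
  rw [show star a * a - 1 + (a * star a - 1) = (2 : ℝ) • ((ℜ a : E) * ℜ a + ℑ a * ℑ a - 1) by
    rw [sub_add_sub_comm, h, two_smul, two_smul]; abel, inv_smul_smul₀ two_ne_zero, two_smul]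
  noncomm_ring

theorem star_one_sub_mul_one_sub (a : E) :
    star (1 - a) * (1 - a) = (2 : ℝ) • (1 - ℜ a : E) + (star a * a - 1) := by
  rw [realPart_apply_coe, smul_sub, smul_inv_smul₀ two_ne_zero, two_smul, star_sub, star_one]
  noncomm_ring

theorem star_mul_one_sub_mul_one_sub (a b : E) :
    star ((1 - b) * (1 - a)) * ((1 - b) * (1 - a)) =
      (4 : ℝ) • ((1 - ℜ a : E) * (1 - ℜ b)) + ((2 : ℝ) • ((star a * a - 1) * (1 - ℜ b)) +
        (2 : ℝ) • (star (1 - a) * ⁅(ℜ b : E), a⁆) +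
          star (1 - a) * (star b * b - 1) * (1 - a)) := by
  have hb := star_one_sub_mul_one_sub b
  have ha : star a * a - 1 = star (1 - a) * (1 - a) - (2 : ℝ) • (1 - ℜ a : E) :=
    eq_sub_of_add_eq' (star_one_sub_mul_one_sub a).symm
  rw [show star ((1 - b) * (1 - a)) * ((1 - b) * (1 - a)) =
    star (1 - a) * (star (1 - b) * (1 - b)) * (1 - a) by rw [star_mul]; noncomm_ring, hb, ha,
    Ring.lie_def]
  simp only [two_smul, show (4 : ℝ) = 2 + 2 by norm_num, add_smul]
  noncomm_ring

end RealAndImaginaryParts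

section Estimates

variable {E : Type*} [CStarAlgebra E] {d : ℕ} {δ : ℝ} {T : Fin d → E}

theorem IsFuzzyTorus.norm_le_two (hT : IsFuzzyTorus δ T) (j : Fin d) : ‖T j‖ ≤ 2 := by
  have h : ‖T j‖ * ‖T j‖ ≤ 2 := calc
    ‖T j‖ * ‖T j‖ = ‖(T j * star (T j) - 1) + 1‖ := by
      rw [sub_add_cancel, CStarRing.norm_self_mul_star]
    _ ≤ δ + 1 := norm_add_le_of_le (hT.norm_mul_star j) (IsStarProjection.one E).norm_le
    _ ≤ 2 := by linarith [hT.width_lt_one]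
  nlinarith

theorem IsFuzzyTorus.norm_one_sub_le (hT : IsFuzzyTorus δ T) (j : Fin d) : ‖1 - T j‖ ≤ 3 :=
  (norm_sub_le_of_le (IsStarProjection.one E).norm_le (hT.norm_le_two j)).trans (by norm_num)

theorem IsFuzzyTorus.norm_one_sub_realPart_le (hT : IsFuzzyTorus δ T) (j : Fin d) :
    ‖(1 - ℜ (T j) : E)‖ ≤ 3 :=
  (norm_sub_le_of_le (IsStarProjection.one E).norm_le
    ((realPart.norm_le (T j)).trans (hT.norm_le_two j))).trans (by norm_num)

theorem IsFuzzyTorus.norm_lie_star_left_le (hT : IsFuzzyTorus δ T) (j l : Fin d) :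
    ‖⁅star (T j), T l⁆‖ ≤ 12 * δ := by
  have ha : ‖star (T j)‖ ≤ 2 := (norm_star _).trans_le (hT.norm_le_two j)
  have hb := hT.norm_le_two l
  have h₁ : ‖1 - T j * star (T j)‖ ≤ δ := norm_sub_rev (1 : E) _ ▸ hT.norm_mul_star j
  have h₂ := norm_mul_le_of_le (norm_mul_le_of_le ha hb) h₁
  have h₃ := norm_mul_le_of_le (norm_mul_le_of_le ha (hT.norm_commutator l j)) ha
  have h₄ := norm_mul_le_of_le (norm_mul_le_of_le (hT.norm_star_mul j) hb) ha
  rw [show ⁅star (T j), T l⁆ = star (T j) * T l * (1 - T j * star (T j)) +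
    star (T j) * (T l * T j - T j * T l) * star (T j) +
      (star (T j) * T j - 1) * T l * star (T j) by rw [Ring.lie_def]; noncomm_ring]
  linarith [norm_add_le_of_le (norm_add_le_of_le h₂ h₃) h₄]

theorem norm_lie_star_star (a b : E) : ‖⁅star a, star b⁆‖ = ‖⁅a, b⁆‖ := by
  rw [← norm_star ⁅a, b⁆, Ring.lie_def, Ring.lie_def, star_sub, star_mul, star_mul, norm_sub_rev]

theorem norm_lie_star_right (a b : E) : ‖⁅a, star b⁆‖ = ‖⁅star a, b⁆‖ := by
  simpa only [star_star] using norm_lie_star_star (star a) b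

theorem IsFuzzyTorus.norm_lie_le (hT : IsFuzzyTorus δ T) (j l : Fin d) :
    ‖⁅T j, T l⁆‖ ≤ 12 * δ :=
  (hT.norm_commutator j l).trans (by linarith [hT.width_nonneg])

theorem IsFuzzyTorus.norm_lie_star_right_le (hT : IsFuzzyTorus δ T) (j l : Fin d) :
    ‖⁅T j, star (T l)⁆‖ ≤ 12 * δ :=
  (norm_lie_star_right _ _).trans_le (hT.norm_lie_star_left_le j l)

theorem IsFuzzyTorus.norm_lie_star_star_le (hT : IsFuzzyTorus δ T) (j l : Fin d) :
    ‖⁅star (T j), star (T l)⁆‖ ≤ 12 * δ :=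
  (norm_lie_star_star _ _).trans_le (hT.norm_lie_le j l)

theorem IsFuzzyTorus.norm_lie_realPart_le (hT : IsFuzzyTorus δ T) (j l : Fin d) :
    ‖⁅(ℜ (T j) : E), T l⁆‖ ≤ 12 * δ :=
  FuzzyTorus.norm_lie_realPart_le (hT.norm_lie_le j l) (hT.norm_lie_star_left_le j l)

theorem norm_lie_comm (a b : E) : ‖⁅a, b⁆‖ = ‖⁅b, a⁆‖ := by
  rw [Ring.lie_def, Ring.lie_def, norm_sub_rev]

theorem IsFuzzyTorus.norm_lie_imaginaryPart_realPart_le (hT : IsFuzzyTorus δ T) (j l : Fin d) :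
    ‖⁅(ℑ (T j) : E), (ℜ (T l) : E)⁆‖ ≤ 12 * δ := by
  have h := hT.norm_lie_realPart_le l j
  have h' := FuzzyTorus.norm_lie_realPart_le
    (hT.norm_lie_star_right_le l j) (hT.norm_lie_star_star_le l j)
  rw [norm_lie_comm] at h h'
  exact norm_lie_imaginaryPart_le h h'

theorem IsFuzzyTorus.norm_lie_imaginaryPart_imaginaryPart_le (hT : IsFuzzyTorus δ T)
    (j l : Fin d) : ‖⁅(ℑ (T j) : E), (ℑ (T l) : E)⁆‖ ≤ 12 * δ := by
  have h := norm_lie_imaginaryPart_le (hT.norm_lie_le l j) (hT.norm_lie_star_left_le l j)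
  have h' := norm_lie_imaginaryPart_le
    (hT.norm_lie_star_right_le l j) (hT.norm_lie_star_star_le l j)
  rw [norm_lie_comm] at h h'
  exact norm_lie_imaginaryPart_le h h'

theorem IsFuzzyTorus.norm_imaginaryPart_sq_add_sub_le (hT : IsFuzzyTorus δ T) (j : Fin d) :
    ‖(ℑ (T j) : E) * ℑ (T j) + (1 - ℜ (T j)) * (1 - ℜ (T j)) - (2 : ℝ) • (1 - ℜ (T j) : E)‖ ≤
      δ := by
  rw [imaginaryPart_mul_self_add_one_sub_realPart_mul_self, add_sub_cancel_left, norm_smul]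
  norm_num
  linarith [norm_add_le_of_le (hT.norm_star_mul j) (hT.norm_mul_star j)]

theorem IsFuzzyTorus.norm_one_sub_realPart_mul_sub_le (hT : IsFuzzyTorus δ T) (j l : Fin d) :
    ‖(1 - ℜ (T j) : E) * (1 - ℜ (T l)) - (4⁻¹ : ℝ) •
      (star ((1 - T l) * (1 - T j)) * ((1 - T l) * (1 - T j)))‖ ≤ 22 * δ := by
  have hj := hT.norm_one_sub_le j
  have hj' : ‖star (1 - T j)‖ ≤ 3 := (norm_star _).trans_le hj
  have h₁ := norm_mul_le_of_le (hT.norm_star_mul j) (hT.norm_one_sub_realPart_le l)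
  have h₂ := norm_mul_le_of_le hj' (hT.norm_lie_realPart_le l j)
  have h₃ := norm_mul_le_of_le (norm_mul_le_of_le hj' (hT.norm_star_mul l)) hj
  rw [star_mul_one_sub_mul_one_sub, smul_add, inv_smul_smul₀ four_ne_zero, sub_add_cancel_left,
    norm_neg, norm_smul, two_smul, two_smul, norm_inv, Real.norm_ofNat]
  linarith [norm_add_le_of_le (norm_add_le_of_le (norm_add_le_of_le h₁ h₁)
    (norm_add_le_of_le h₂ h₂)) h₃, hT.width_nonneg]

end Estimates

section SumOfSquares

attribute [local instance] CStarAlgebra.spectralOrder CStarAlgebra.spectralOrderedRing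

variable {E : Type*} [CStarAlgebra E] {k : ℕ} {δ : ℝ} {T : Fin k → E}

/-- The positive element that approximates the mixed terms `(1 - Re T_j)(1 - Re T_l)`, `j ≠ l`,
of the square of `∑ j, (1 - Re T_j)`. -/
def crossTerm (T : Fin k → E) : E :=
  ∑ j, ∑ l ∈ Finset.univ.erase j,
    (4⁻¹ : ℝ) • (star ((1 - T l) * (1 - T j)) * ((1 - T l) * (1 - T j)))

theorem crossTerm_nonneg (T : Fin k → E) : 0 ≤ crossTerm T :=
  Finset.sum_nonneg fun _ _ => Finset.sum_nonneg fun _ _ =>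
    smul_nonneg (by norm_num) (star_mul_self_nonneg _)

theorem IsFuzzyTorus.norm_sum_sq_sub_crossTerm_le (hT : IsFuzzyTorus δ T) :
    ‖∑ j, (ℑ (T j) : E) * ℑ (T j) + (∑ j, (1 - ℜ (T j) : E)) * ∑ j, (1 - ℜ (T j) : E) -
      (2 : ℝ) • ∑ j, (1 - ℜ (T j) : E) - crossTerm T‖ ≤ 23 * k ^ 2 * δ := by
  set e : Fin k → E := fun j => 1 - ℜ (T j)
  have hsplit : (∑ j, e j) * ∑ j, e j =
      ∑ j, e j * e j + ∑ j, ∑ l ∈ Finset.univ.erase j, e j * e l := by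
    rw [Finset.sum_mul_sum, ← Finset.sum_add_distrib]
    exact Finset.sum_congr rfl fun j _ => (Finset.add_sum_erase _ _ (Finset.mem_univ j)).symm
  have hdiag : ‖∑ j, ((ℑ (T j) : E) * ℑ (T j) + e j * e j - (2 : ℝ) • e j)‖ ≤ k * δ := by
    simpa using norm_sum_le_of_le Finset.univ fun j _ => hT.norm_imaginaryPart_sq_add_sub_le j
  have hcross : ‖∑ j, ∑ l ∈ Finset.univ.erase j, (e j * e l -
      (4⁻¹ : ℝ) • (star ((1 - T l) * (1 - T j)) * ((1 - T l) * (1 - T j))))‖ ≤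
        ∑ _j : Fin k, ∑ _l : Fin k, 22 * δ :=
    norm_sum_le_of_le _ fun j _ =>
      (norm_sum_le_of_le _ fun l _ => hT.norm_one_sub_realPart_mul_sub_le j l).trans
        (Finset.sum_le_sum_of_subset_of_nonneg (Finset.erase_subset _ _)
          fun _ _ _ => mul_nonneg (by norm_num) hT.width_nonneg)
  have hk : (k : ℝ) ≤ k ^ 2 := by exact_mod_cast Nat.le_self_pow two_ne_zero k
  have heq : ∑ j, (ℑ (T j) : E) * ℑ (T j) + (∑ j, e j) * ∑ j, e j - (2 : ℝ) • ∑ j, e j -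
      crossTerm T = ∑ j, ((ℑ (T j) : E) * ℑ (T j) + e j * e j - (2 : ℝ) • e j) +
        ∑ j, ∑ l ∈ Finset.univ.erase j, (e j * e l -
          (4⁻¹ : ℝ) • (star ((1 - T l) * (1 - T j)) * ((1 - T l) * (1 - T j)))) := by
    rw [hsplit, crossTerm]
    simp only [Finset.sum_sub_distrib, Finset.sum_add_distrib, Finset.smul_sum]
    abel
  rw [heq]
  refine (norm_add_le_of_le hdiag hcross).trans ?_
  simp only [Finset.sum_const, Finset.card_univ, Fintype.card_fin, nsmul_eq_mul]
  nlinarith [mul_le_mul_of_nonneg_right hk hT.width_nonneg]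

theorem IsFuzzyTorus.norm_two_smul_sum_one_sub_realPart_sub_le (hT : IsFuzzyTorus δ T) :
    ‖(2 : ℝ) • ∑ j, (1 - ℜ (T j) : E) - ∑ j, star (1 - T j) * (1 - T j)‖ ≤ k * δ := by
  rw [Finset.smul_sum, ← Finset.sum_sub_distrib]
  simpa using norm_sum_le_of_le (n := fun _ => δ) Finset.univ fun j _ => show
    ‖(2 : ℝ) • (1 - ℜ (T j) : E) - star (1 - T j) * (1 - T j)‖ ≤ δ by
      rw [star_one_sub_mul_one_sub, sub_add_cancel_left, norm_neg]
      exact hT.norm_star_mul j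

theorem commute_star_right {p x : E} (hp : IsSelfAdjoint p) (h : Commute p x) :
    Commute p (star x) := by
  simpa only [hp.star_eq] using h.star_star

theorem commute_realPart {p x : E} (hp : IsSelfAdjoint p) (h : Commute p x) :
    Commute p (ℜ x : E) := by
  rw [realPart_apply_coe]
  exact (h.add_right (commute_star_right hp h)).smul_right _

theorem commute_imaginaryPart {p x : E} (hp : IsSelfAdjoint p) (h : Commute p x) :
    Commute p (ℑ x : E) := by
  rw [imaginaryPart_apply_coe]
  exact ((h.sub_right (commute_star_right hp h)).smul_right _).smul_right _

theorem commute_crossTerm {p : E} (hp : IsSelfAdjoint p) (h : ∀ j, Commute p (T j)) :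
    Commute p (crossTerm T) := by
  refine Commute.sum_right _ _ _ fun j _ => Commute.sum_right _ _ _ fun l _ => ?_
  have hX : Commute p ((1 - T l) * (1 - T j)) :=
    ((Commute.one_right p).sub_right (h l)).mul_right ((Commute.one_right p).sub_right (h j))
  exact ((commute_star_right hp hX).mul_right hX).smul_right _

theorem mul_self_mul_nonneg {w c : E} (hw : IsSelfAdjoint w) (hc : 0 ≤ c) (h : Commute w c) :
    0 ≤ w * w * c := by
  rw [mul_assoc, h.eq, ← mul_assoc]
  exact hw.conjugate_nonneg hc

end SumOfSquares

section Weights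

attribute [local instance] CStarAlgebra.spectralOrder CStarAlgebra.spectralOrderedRing

variable {E : Type*} [CStarAlgebra E] {k : ℕ} {δ a b : ℝ} {p : E}

theorem mul_two_mul_sub_one (hp : IsIdempotentElem p) : p * (2 * p - 1) = p := by
  rw [mul_sub, mul_one, two_mul, mul_add, hp.eq, add_sub_cancel_right]

theorem two_mul_sub_one_mul_self (hp : IsIdempotentElem p) : (2 * p - 1) * (2 * p - 1) = 1 := by
  rw [sub_mul, mul_assoc, mul_two_mul_sub_one hp, one_mul, sub_sub_cancel]

theorem isSelfAdjoint_two_mul_sub_one (hp : IsSelfAdjoint p) : IsSelfAdjoint (2 * p - 1) := by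
  rw [two_mul]
  exact (hp.add hp).sub (.one E)

/-- The weight `a + b p`: for a torus commuting with `p`, it encodes the convex combination with
coefficients `a` and `b` of the torus and its compression by `p`. -/
def weight (p : E) (a b : ℝ) : E :=
  a • 1 + b • p

theorem isSelfAdjoint_weight (hp : IsSelfAdjoint p) (a b : ℝ) :
    IsSelfAdjoint (weight p a b) :=
  ((IsSelfAdjoint.all a).smul (.one E)).add ((IsSelfAdjoint.all b).smul hp)

theorem norm_weight_le (hp : IsStarProjection p) (ha : 0 ≤ a) (hb : 0 ≤ b) (hab : a + b = 1) :
    ‖weight p a b‖ ≤ 1 := by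
  calc
    ‖weight p a b‖ ≤ a * ‖(1 : E)‖ + b * ‖p‖ := by
      simpa only [weight, norm_smul, Real.norm_of_nonneg, ha, hb] using
        norm_add_le (a • (1 : E)) (b • p)
    _ ≤ a * 1 + b * 1 := by gcongr; exacts [(IsStarProjection.one E).norm_le, hp.norm_le]
    _ = 1 := by rw [mul_one, mul_one, hab]

theorem commute_weight {x : E} (h : Commute p x) (a b : ℝ) :
    Commute (weight p a b) x :=
  ((Commute.one_left x).smul_left a).add_left (h.smul_left b)

theorem weight_mul_self_sub (hp : IsIdempotentElem p) (hab : a + b = 1) :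
    weight p a b * weight p a b - weight p a b * (2 * p - 1) =
      (a * (a + 1)) • ((1 - p) * (1 - p)) := by
  obtain rfl : b = 1 - a := by linarith
  rw [hp.one_sub.eq]
  simp only [weight, add_mul, mul_add, smul_mul_assoc, mul_smul_comm, one_mul, mul_one, hp.eq,
    two_mul, mul_sub]
  module

theorem commute_two_mul_sub_one {x : E} (h : Commute p x) : Commute (2 * p - 1) x :=
  ((Commute.ofNat_left 2 x).mul_left h).sub_left (.one_left x)

theorem commute_sum_one_sub_realPart {T : Fin k → E} (hp : IsSelfAdjoint p)
    (hTp : ∀ j, Commute p (T j)) : Commute p (∑ j, (1 - ℜ (T j) : E)) :=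
  Commute.sum_right _ _ _ fun j _ =>
    (Commute.one_right p).sub_right (commute_realPart hp (hTp j))

theorem commute_sum_star_one_sub_mul {T : Fin k → E} (hp : IsSelfAdjoint p)
    (hTp : ∀ j, Commute p (T j)) : Commute p (∑ j, star (1 - T j) * (1 - T j)) :=
  Commute.sum_right _ _ _ fun j _ =>
    have h := (Commute.one_right p).sub_right (hTp j)
    (commute_star_right hp h).mul_right h

theorem sum_sq_weighted_eq {ι : Type*} [Fintype ι] {R : Type*} [Ring R] {w S e : R} {s : ι → R}
    (hs : ∀ j, Commute w (s j)) (he : Commute w e) (hS : S * S = 1) (hSw : Commute S w)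
    (hSe : Commute S e) :
    ∑ j, w * s j * (w * s j) + (w * e - S) * (w * e - S) =
      1 + (w * w * (∑ j, s j * s j + e * e - (e + e)) + (w * w - w * S) * (e + e)) := by
  have hsq : ∑ j, w * s j * (w * s j) = w * w * ∑ j, s j * s j := by
    rw [Finset.mul_sum]
    exact Finset.sum_congr rfl fun j _ => (hs j).symm.mul_mul_mul_comm w (s j)
  have hSwe : S * (w * e) = w * e * S := (hSw.mul_right hSe).eq
  have hlast : (w * e - S) * (w * e - S) = w * w * (e * e) - (w * e * S + w * e * S) + 1 := by
    rw [sub_mul, mul_sub, mul_sub, hS, he.symm.mul_mul_mul_comm w e, hSwe]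
    abel
  have hweS : w * e * S = w * S * e := by rw [mul_assoc, ← hSe.eq, mul_assoc]
  rw [hsq, hlast, hweS]
  noncomm_ring

/-- The positive part consists of the mixed terms `w² crossTerm T`, `w = weight p a b`, and of the
contribution of `w² - w (2 p - 1) = a (a + 1) (1 - p) ≥ 0`. -/
theorem IsFuzzyTorus.exists_nonneg_norm_sum_sq_sub_le {T : Fin k → E} (hT : IsFuzzyTorus δ T)
    (hp : IsStarProjection p) (hTp : ∀ j, Commute p (T j)) (ha : 0 ≤ a) (hb : 0 ≤ b)
    (hab : a + b = 1) :
    ∃ c : E, 0 ≤ c ∧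
      ‖∑ j, weight p a b * ℑ (T j) * (weight p a b * ℑ (T j)) +
        (weight p a b * ∑ j, (1 - ℜ (T j) : E) - (2 * p - 1)) *
          (weight p a b * ∑ j, (1 - ℜ (T j) : E) - (2 * p - 1)) - (1 + c)‖ ≤
            25 * k ^ 2 * δ := by
  set w := weight p a b
  set e : E := ∑ j, (1 - ℜ (T j) : E)
  set f : E := ∑ j, star (1 - T j) * (1 - T j)
  have hpe : Commute p e := commute_sum_one_sub_realPart hp.isSelfAdjoint hTp
  have hpf : Commute p f := commute_sum_star_one_sub_mul hp.isSelfAdjoint hTp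
  have hk : (k : ℝ) ≤ k ^ 2 := by exact_mod_cast Nat.le_self_pow two_ne_zero k
  have ha₂ : ‖a * (a + 1)‖ ≤ 2 := by
    rw [Real.norm_of_nonneg (by positivity)]; nlinarith
  have hw := norm_weight_le hp ha hb hab
  have hq := hp.one_sub.norm_le
  have hwc := commute_weight (commute_crossTerm hp.isSelfAdjoint hTp) a b
  have hc : 0 ≤ w * w * crossTerm T + (a * (a + 1)) • ((1 - p) * (1 - p) * f) :=
    add_nonneg
      (mul_self_mul_nonneg (isSelfAdjoint_weight hp.isSelfAdjoint a b) (crossTerm_nonneg T) hwc)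
      (smul_nonneg (by positivity) (mul_self_mul_nonneg hp.one_sub.isSelfAdjoint
        (Finset.sum_nonneg fun _ _ => star_mul_self_nonneg _) ((Commute.one_left f).sub_left hpf)))
  refine ⟨_, hc, ?_⟩
  rw [sum_sq_weighted_eq
      (fun j => commute_weight (commute_imaginaryPart hp.isSelfAdjoint (hTp j)) a b)
      (commute_weight hpe a b) (two_mul_sub_one_mul_self hp.isIdempotentElem)
      (commute_two_mul_sub_one (commute_weight (.refl p) a b).symm) (commute_two_mul_sub_one hpe),
    weight_mul_self_sub hp.isIdempotentElem hab, ← two_smul ℝ e, add_sub_add_left_eq_sub,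
    smul_mul_assoc, add_sub_add_comm, ← mul_sub, ← smul_sub, ← mul_sub]
  have h₁ := norm_mul_le_of_le (norm_mul_le_of_le hw hw) hT.norm_sum_sq_sub_crossTerm_le
  have h₂ := norm_mul_le_of_le (norm_mul_le_of_le hq hq)
    hT.norm_two_smul_sum_one_sub_realPart_sub_le
  refine (norm_add_le_of_le h₁ ((norm_smul_le _ _).trans
    (mul_le_mul ha₂ h₂ (norm_nonneg _) zero_le_two))).trans ?_
  nlinarith [mul_le_mul_of_nonneg_right hk hT.width_nonneg,
    mul_nonneg (Nat.cast_nonneg (α := ℝ) k) hT.width_nonneg]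

end Weights

section Tensors

attribute [local instance] CStarAlgebra.spectralOrder CStarAlgebra.spectralOrderedRing

variable {E : Type*} [CStarAlgebra E] {k n : ℕ}

theorem tens_apply (a : E) (γ : Matrix (Fin n) (Fin n) ℂ) (i j : Fin n) :
    tens a γ i j = γ i j • a := rfl

theorem tens_mul_tens (a b : E) (γ γ' : Matrix (Fin n) (Fin n) ℂ) :
    tens a γ * tens b γ' = tens (a * b) (γ * γ') := by
  ext i j
  simp [CStarMatrix.mul_apply, tens_apply, Matrix.mul_apply, Finset.sum_smul, smul_smul, mul_comm]

theorem star_tens (a : E) (γ : Matrix (Fin n) (Fin n) ℂ) : star (tens a γ) = tens (star a) γᴴ := by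
  ext i j
  simp [CStarMatrix.star_apply, tens_apply]

theorem tens_one_one : tens (1 : E) (1 : Matrix (Fin n) (Fin n) ℂ) = 1 := by
  ext i j
  rw [tens_apply, CStarMatrix.one_apply, Matrix.one_apply, ite_smul, one_smul, zero_smul]

theorem scal_eq_tens (γ : Matrix (Fin n) (Fin n) ℂ) : scal E γ = tens 1 γ := by
  ext i j
  exact Algebra.algebraMap_eq_smul_one _

theorem tens_add_left (a b : E) (γ : Matrix (Fin n) (Fin n) ℂ) :
    tens (a + b) γ = tens a γ + tens b γ := by
  ext i j
  exact smul_add (γ i j) a b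

theorem tens_sub_left (a b : E) (γ : Matrix (Fin n) (Fin n) ℂ) :
    tens (a - b) γ = tens a γ - tens b γ := by
  ext i j
  exact smul_sub (γ i j) a b

theorem tens_smul_left {S : Type*} [SMul S E] [SMulCommClass ℂ S E] (z : S) (a : E)
    (γ : Matrix (Fin n) (Fin n) ℂ) : tens (z • a) γ = z • tens a γ := by
  ext i j
  exact smul_comm (γ i j) z a

theorem tens_neg_right (a : E) (γ : Matrix (Fin n) (Fin n) ℂ) : tens a (-γ) = -tens a γ := by
  ext i j
  exact neg_smul (γ i j) a

/-- The diagonal embedding `a ↦ a ⊗ 1` of `E` into `Mₙ(E)` as a unital ⋆-homomorphism. -/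
def tensOne (E : Type*) [CStarAlgebra E] (n : ℕ) : E →⋆ₐ[ℂ] CStarMatrix (Fin n) (Fin n) E where
  toFun a := tens a 1
  map_one' := tens_one_one
  map_mul' a b := by rw [tens_mul_tens, one_mul]
  map_zero' := by simpa only [sub_self] using tens_sub_left (0 : E) 0 1
  map_add' a b := tens_add_left a b 1
  commutes' z := by
    rw [Algebra.algebraMap_eq_smul_one, tens_smul_left, tens_one_one,
      Algebra.algebraMap_eq_smul_one]
  map_star' a := by rw [star_tens, Matrix.conjTranspose_one]

theorem tensOne_apply (a : E) : tensOne E n a = tens a 1 := rfl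

/-- A selfadjoint representation on `ℂⁿ` of the Clifford algebra with `k` generators, not
necessarily irreducible. -/
structure IsClifford (γ : Fin k → Matrix (Fin n) (Fin n) ℂ) : Prop where
  isHermitian : ∀ i, (γ i).IsHermitian
  sq_eq_one : ∀ i, γ i * γ i = 1
  anticommute : ∀ i j, i ≠ j → γ i * γ j = -(γ j * γ i)

theorem IsIrreducibleClifford.isClifford {γ : Fin k → Matrix (Fin n) (Fin n) ℂ}
    (hγ : IsIrreducibleClifford γ) : IsClifford γ :=
  ⟨hγ.isHermitian, hγ.sq_eq_one, hγ.anticommute⟩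

theorem IsClifford.conjTranspose_mul_self {γ : Fin k → Matrix (Fin n) (Fin n) ℂ}
    (hγ : IsClifford γ) (i : Fin k) : (γ i)ᴴ * γ i = 1 := by
  rw [hγ.isHermitian, hγ.sq_eq_one]

/-- The combination `∑ i, y i ⊗ γ i` of Clifford generators with coefficients in `E`. -/
def cliffordSum (y : Fin k → E) (γ : Fin k → Matrix (Fin n) (Fin n) ℂ) :
    CStarMatrix (Fin n) (Fin n) E :=
  ∑ i, tens (y i) (γ i)

theorem cliffordSum_add (y z : Fin k → E) (γ : Fin k → Matrix (Fin n) (Fin n) ℂ) :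
    cliffordSum (y + z) γ = cliffordSum y γ + cliffordSum z γ := by
  simp only [cliffordSum, Pi.add_apply, tens_add_left, Finset.sum_add_distrib]

theorem cliffordSum_sub (y z : Fin k → E) (γ : Fin k → Matrix (Fin n) (Fin n) ℂ) :
    cliffordSum (y - z) γ = cliffordSum y γ - cliffordSum z γ := by
  simp only [cliffordSum, Pi.sub_apply, tens_sub_left, Finset.sum_sub_distrib]

theorem cliffordSum_smul (r : ℝ) (y : Fin k → E) (γ : Fin k → Matrix (Fin n) (Fin n) ℂ) :
    cliffordSum (r • y) γ = r • cliffordSum y γ := by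
  simp only [cliffordSum, Pi.smul_apply, tens_smul_left, Finset.smul_sum]

theorem isSelfAdjoint_cliffordSum {y : Fin k → E} {γ : Fin k → Matrix (Fin n) (Fin n) ℂ}
    (hγ : ∀ i, (γ i).IsHermitian) (hy : ∀ i, IsSelfAdjoint (y i)) :
    IsSelfAdjoint (cliffordSum y γ) :=
  isSelfAdjoint_sum _ fun i _ => by rw [isSelfAdjoint_iff, star_tens, (hy i).star_eq, (hγ i).eq]

theorem scal_mul_cliffordSum (y : Fin k → E) {γ : Fin k → Matrix (Fin n) (Fin n) ℂ}
    {Γ : Matrix (Fin n) (Fin n) ℂ} (hΓ : ∀ i, Γ * γ i = -(γ i * Γ)) :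
    scal E Γ * cliffordSum y γ = -(cliffordSum y γ * scal E Γ) := by
  rw [scal_eq_tens, cliffordSum, Finset.mul_sum, Finset.sum_mul, ← Finset.sum_neg_distrib]
  refine Finset.sum_congr rfl fun i _ => ?_
  rw [tens_mul_tens, tens_mul_tens, hΓ, tens_neg_right, one_mul, mul_one]

theorem norm_tens_le (a : E) {γ : Matrix (Fin n) (Fin n) ℂ} (hγ : γᴴ * γ = 1) :
    ‖tens a γ‖ ≤ ‖a‖ := by
  refine le_of_sq_le_sq ?_ (norm_nonneg a)
  rw [sq, sq, ← CStarRing.norm_star_mul_self, ← CStarRing.norm_star_mul_self, star_tens,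
    tens_mul_tens, hγ, ← tensOne_apply]
  exact NonUnitalStarAlgHom.norm_apply_le (tensOne E n) _

theorem norm_cliffordSum_le (y : Fin k → E) {γ : Fin k → Matrix (Fin n) (Fin n) ℂ}
    (hγ : IsClifford γ) : ‖cliffordSum y γ‖ ≤ ∑ i, ‖y i‖ :=
  norm_sum_le_of_le _ fun i _ => norm_tens_le _ (hγ.conjTranspose_mul_self i)

theorem two_smul_cliffordSum_mul_self_sub (y : Fin k → E)
    {γ : Fin k → Matrix (Fin n) (Fin n) ℂ} (hγ : IsClifford γ) :
    (2 : ℂ) • (cliffordSum y γ * cliffordSum y γ - tensOne E n (∑ i, y i * y i)) =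
      ∑ i, ∑ j ∈ Finset.univ.erase i, tens ⁅y i, y j⁆ (γ i * γ j) := by
  have hprod : cliffordSum y γ * cliffordSum y γ = ∑ i, ∑ j, tens (y i * y j) (γ i * γ j) := by
    simp only [cliffordSum, Finset.sum_mul_sum, tens_mul_tens]
  have hdiag : tensOne E n (∑ i, y i * y i) = ∑ i, tens (y i * y i) (γ i * γ i) := by
    simp only [map_sum, tensOne_apply, hγ.sq_eq_one]
  have hoff : cliffordSum y γ * cliffordSum y γ - tensOne E n (∑ i, y i * y i) =
      ∑ i, ∑ j ∈ Finset.univ.erase i, tens (y i * y j) (γ i * γ j) := by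
    rw [hprod, hdiag, ← Finset.sum_sub_distrib]
    exact Finset.sum_congr rfl fun i _ => (Finset.sum_erase_eq_sub (Finset.mem_univ i)).symm
  have hswap : ∑ i, ∑ j ∈ Finset.univ.erase i, tens (y i * y j) (γ i * γ j) =
      ∑ i, ∑ j ∈ Finset.univ.erase i, tens (y j * y i) (γ j * γ i) :=
    Finset.sum_comm' (by simp [ne_comm])
  rw [two_smul, hoff]
  nth_rw 2 [hswap]
  simp only [← Finset.sum_add_distrib]
  refine Finset.sum_congr rfl fun i _ => Finset.sum_congr rfl fun j hj => ?_
  rw [hγ.anticommute j i (Finset.ne_of_mem_erase hj), tens_neg_right, ← sub_eq_add_neg,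
    ← tens_sub_left, Ring.lie_def]

theorem norm_cliffordSum_mul_self_sub_le {y : Fin k → E} {γ : Fin k → Matrix (Fin n) (Fin n) ℂ}
    (hγ : IsClifford γ) {η : ℝ} (hη : ∀ i j, ‖⁅y i, y j⁆‖ ≤ η) :
    ‖cliffordSum y γ * cliffordSum y γ - tensOne E n (∑ i, y i * y i)‖ ≤ k ^ 2 * η := by
  have hunitary : ∀ i j, (γ i * γ j)ᴴ * (γ i * γ j) = 1 := fun i j => by
    rw [Matrix.conjTranspose_mul, Matrix.mul_assoc, ← Matrix.mul_assoc _ (γ i),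
      hγ.conjTranspose_mul_self, Matrix.one_mul, hγ.conjTranspose_mul_self]
  have hsum : ‖∑ i, ∑ j ∈ Finset.univ.erase i, tens ⁅y i, y j⁆ (γ i * γ j)‖ ≤
      ∑ _i : Fin k, ∑ _j : Fin k, η :=
    norm_sum_le_of_le _ fun i _ =>
      (norm_sum_le_of_le _ fun j _ => (norm_tens_le _ (hunitary i j)).trans (hη i j)).trans
        (Finset.sum_le_sum_of_subset_of_nonneg (Finset.erase_subset _ _)
          fun j _ _ => (norm_nonneg _).trans (hη i j))
  rw [← two_smul_cliffordSum_mul_self_sub y hγ, norm_smul, Complex.norm_ofNat] at hsum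
  simp only [Finset.sum_const, Finset.card_univ, Fintype.card_fin, nsmul_eq_mul] at hsum
  linarith [norm_nonneg (cliffordSum y γ * cliffordSum y γ - tensOne E n (∑ i, y i * y i))]

end Tensors

section Invertibility

attribute [local instance] CStarAlgebra.spectralOrder CStarAlgebra.spectralOrderedRing

variable {E : Type*} [CStarAlgebra E] {M N : E} {c r : ℝ}

theorem algebraMap_sub_le_of_norm_sub_le {x y : E} (hx : IsSelfAdjoint x) (hy : IsSelfAdjoint y)
    (hc : algebraMap ℝ E c ≤ y) (h : ‖x - y‖ ≤ r) : algebraMap ℝ E (c - r) ≤ x := calc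
  algebraMap ℝ E (c - r) = -algebraMap ℝ E r + algebraMap ℝ E c := by rw [map_sub]; abel
  _ ≤ -algebraMap ℝ E ‖x - y‖ + algebraMap ℝ E c := by gcongr
  _ ≤ (x - y) + y := add_le_add (hx.sub hy).neg_algebraMap_norm_le_self hc
  _ = x := sub_add_cancel x y

theorem mul_self_le_two_smul_add (hM : IsSelfAdjoint M) (hN : IsSelfAdjoint N) :
    M * M ≤ (2 : ℝ) • (N * N) + (2 : ℝ) • ((N - M) * (N - M)) := by
  have h := (hN.add (hN.sub hM)).mul_self_nonneg
  rw [← sub_nonneg]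
  convert h using 1
  simp only [two_smul]
  noncomm_ring

theorem isUnit_of_algebraMap_le_mul_self (hc : 0 < c)
    (h : algebraMap ℝ E c ≤ N * N) : IsUnit N := by
  have h₂ : IsUnit (N ^ 2) := by
    rw [sq]
    exact CStarAlgebra.isUnit_of_le _ h (isStrictlyPositive_algebraMap hc)
  exact (isUnit_pow_iff two_ne_zero).1 h₂

theorem isUnit_of_norm_sub_le (hM : IsSelfAdjoint M) (hN : IsSelfAdjoint N)
    (hc : algebraMap ℝ E c ≤ M * M) (hMN : ‖N - M‖ ≤ r) (hr : 2 * r ^ 2 < c) : IsUnit N := by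
  have hNM : IsSelfAdjoint (N - M) := hN.sub hM
  have hsq : (N - M) * (N - M) ≤ algebraMap ℝ E (r ^ 2) := calc
    (N - M) * (N - M) ≤ algebraMap ℝ E ‖(N - M) * (N - M)‖ :=
      (IsSelfAdjoint.of_nonneg (IsSelfAdjoint.mul_self_nonneg hNM)).le_algebraMap_norm_self
    _ ≤ algebraMap ℝ E (r ^ 2) := by
      rw [hNM.norm_mul_self]
      gcongr
  have hN₂ : algebraMap ℝ E (c - 2 * r ^ 2) ≤ (2 : ℝ) • (N * N) := calc
    algebraMap ℝ E (c - 2 * r ^ 2) = algebraMap ℝ E c - (2 : ℝ) • algebraMap ℝ E (r ^ 2) := by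
      rw [map_sub, map_mul, ← Algebra.smul_def]
    _ ≤ M * M - (2 : ℝ) • ((N - M) * (N - M)) := by gcongr
    _ ≤ (2 : ℝ) • (N * N) := sub_le_iff_le_add.2 (mul_self_le_two_smul_add hM hN)
  refine isUnit_of_algebraMap_le_mul_self (c := (c - 2 * r ^ 2) / 2) (by linarith) ?_
  calc algebraMap ℝ E ((c - 2 * r ^ 2) / 2) = (2⁻¹ : ℝ) • algebraMap ℝ E (c - 2 * r ^ 2) := by
        rw [div_eq_inv_mul, map_mul, ← Algebra.smul_def]
    _ ≤ (2⁻¹ : ℝ) • (2 : ℝ) • (N * N) := by gcongr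
    _ = N * N := inv_smul_smul₀ two_ne_zero _

end Invertibility

section Coefficients

attribute [local instance] CStarAlgebra.spectralOrder CStarAlgebra.spectralOrderedRing

variable {E : Type*} [CStarAlgebra E] {k n : ℕ} {δ a b : ℝ} {p : E} {T : Fin k → E}

/-- The coefficients `Im T₁, …, Im T_k, ∑ⱼ (1 - Re Tⱼ) - h` of the `G`-operator of a torus graded
by `h`; the ungraded `G`-operator is the case `h = 1`. -/
def gCoeff (h : E) (T : Fin k → E) : Fin (k + 1) → E :=
  Fin.snoc (α := fun _ => E) (fun j => ℑ (T j)) (∑ j, (1 - ℜ (T j) : E) - h)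

/-- The coefficients of the `G`-operator of the compression of `T` by a projection `p`, completed
by `1 - p` in the last entry. -/
def restrictedCoeff (p : E) (T : Fin k → E) : Fin (k + 1) → E :=
  Fin.snoc (α := fun _ => E) (fun j => p * ℑ (T j) * p)
    (p * (∑ j, (1 - ℜ (T j) : E)) * p - (2 * p - 1))

/-- The coefficients of the convex combination `a G + b Gᵖ` of the `G`-operator of a torus graded
by `2 p - 1` and the restricted one, when the torus commutes with `p`. -/
def weightedCoeff (p : E) (a b : ℝ) (T : Fin k → E) : Fin (k + 1) → E :=
  Fin.snoc (α := fun _ => E) (fun j => weight p a b * ℑ (T j))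
    (weight p a b * ∑ j, (1 - ℜ (T j) : E) - (2 * p - 1))

theorem isSelfAdjoint_sum_one_sub_realPart (T : Fin k → E) :
    IsSelfAdjoint (∑ j, (1 - ℜ (T j) : E)) :=
  isSelfAdjoint_sum _ fun j _ => (IsSelfAdjoint.one E).sub (ℜ (T j)).2

theorem isSelfAdjoint_gCoeff {h : E} (hh : IsSelfAdjoint h) (T : Fin k → E) (i : Fin (k + 1)) :
    IsSelfAdjoint (gCoeff h T i) := by
  induction i using Fin.lastCases with
  | last => simpa only [gCoeff, Fin.snoc_last] using (isSelfAdjoint_sum_one_sub_realPart T).sub hh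
  | cast j =>
    rw [gCoeff, Fin.snoc_castSucc]
    exact (ℑ (T j)).2

theorem isSelfAdjoint_restrictedCoeff (hp : IsSelfAdjoint p) (T : Fin k → E) (i : Fin (k + 1)) :
    IsSelfAdjoint (restrictedCoeff p T i) := by
  induction i using Fin.lastCases with
  | last =>
    simpa only [restrictedCoeff, Fin.snoc_last] using
      ((isSelfAdjoint_sum_one_sub_realPart T).conjugate_self hp).sub
        (isSelfAdjoint_two_mul_sub_one hp)
  | cast j =>
    simpa only [restrictedCoeff, Fin.snoc_castSucc] using
      IsSelfAdjoint.conjugate_self (ℑ (T j)).2 hp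

theorem smul_add_smul_mul_mul_eq_weight_mul {x : E} (hp : IsIdempotentElem p) (hx : Commute p x) :
    a • x + b • (p * x * p) = weight p a b * x := by
  rw [hx.eq, mul_assoc, hp.eq, ← hx.eq, weight, add_mul, smul_mul_assoc, smul_mul_assoc, one_mul]

theorem smul_gCoeff_add_smul_restrictedCoeff (hp : IsStarProjection p)
    (hTp : ∀ j, Commute p (T j)) (hab : a + b = 1) :
    a • gCoeff (2 * p - 1) T + b • restrictedCoeff p T = weightedCoeff p a b T := by
  ext i
  rw [Pi.add_apply, Pi.smul_apply, Pi.smul_apply]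
  induction i using Fin.lastCases with
  | last =>
    simp only [gCoeff, restrictedCoeff, weightedCoeff, Fin.snoc_last]
    rw [← smul_add_smul_mul_mul_eq_weight_mul hp.isIdempotentElem
        (commute_sum_one_sub_realPart hp.isSelfAdjoint hTp), smul_sub a _ (2 * p - 1),
      smul_sub b _ (2 * p - 1), sub_add_sub_comm, ← add_smul, hab, one_smul]
  | cast j =>
    simp only [gCoeff, restrictedCoeff, weightedCoeff, Fin.snoc_castSucc]
    exact smul_add_smul_mul_mul_eq_weight_mul hp.isIdempotentElem
      (commute_imaginaryPart hp.isSelfAdjoint (hTp j))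

theorem norm_lie_mul_mul_le {w x y : E} (hw : ‖w‖ ≤ 1) (hx : Commute w x) (hy : Commute w y) :
    ‖⁅w * x, w * y⁆‖ ≤ ‖⁅x, y⁆‖ := by
  have h : ⁅w * x, w * y⁆ = w * w * ⁅x, y⁆ := by
    rw [Ring.lie_def, Ring.lie_def, hx.symm.mul_mul_mul_comm, hy.symm.mul_mul_mul_comm, mul_sub]
  rw [h]
  simpa only [one_mul] using norm_mul_le_of_le (norm_mul_le_of_le hw hw) le_rfl

theorem IsFuzzyTorus.norm_lie_imaginaryPart_sum_one_sub_realPart_le (hT : IsFuzzyTorus δ T)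
    (i : Fin k) : ‖⁅(ℑ (T i) : E), ∑ j, (1 - ℜ (T j) : E)⁆‖ ≤ 12 * (k + 1) * δ := by
  have h : ⁅(ℑ (T i) : E), ∑ j, (1 - ℜ (T j) : E)⁆ =
      -∑ j, ⁅(ℑ (T i) : E), (ℜ (T j) : E)⁆ := by
    simp only [Ring.lie_def, Finset.mul_sum, Finset.sum_mul, ← Finset.sum_sub_distrib,
      ← Finset.sum_neg_distrib]
    exact Finset.sum_congr rfl fun j _ => by noncomm_ring
  rw [h, norm_neg]
  have hsum := norm_sum_le_of_le (n := fun _ => 12 * δ) Finset.univ fun j _ =>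
    hT.norm_lie_imaginaryPart_realPart_le i j
  simp only [Finset.sum_const, Finset.card_univ, Fintype.card_fin, nsmul_eq_mul] at hsum
  linarith [hT.width_nonneg]

theorem IsFuzzyTorus.norm_lie_weightedCoeff_le (hT : IsFuzzyTorus δ T) (hp : IsStarProjection p)
    (hTp : ∀ j, Commute p (T j)) (ha : 0 ≤ a) (hb : 0 ≤ b) (hab : a + b = 1)
    (i j : Fin (k + 1)) :
    ‖⁅weightedCoeff p a b T i, weightedCoeff p a b T j⁆‖ ≤ 12 * (k + 1) * δ := by
  have hw := norm_weight_le hp ha hb hab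
  have hpi (l : Fin k) : Commute p (ℑ (T l) : E) := commute_imaginaryPart hp.isSelfAdjoint (hTp l)
  have hpe := commute_sum_one_sub_realPart hp.isSelfAdjoint hTp
  have hlast (l : Fin k) : ‖⁅weight p a b * ℑ (T l),
      weight p a b * ∑ j, (1 - ℜ (T j) : E) - (2 * p - 1)⁆‖ ≤ 12 * (k + 1) * δ := by
    have hS : Commute (2 * p - 1) (weight p a b * ℑ (T l)) :=
      commute_two_mul_sub_one ((commute_weight (.refl p) a b).symm.mul_right (hpi l))
    rw [Ring.lie_def, mul_sub, sub_mul, hS.eq, sub_sub_sub_cancel_right, ← Ring.lie_def]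
    exact (norm_lie_mul_mul_le hw (commute_weight (hpi l) a b) (commute_weight hpe a b)).trans
      (hT.norm_lie_imaginaryPart_sum_one_sub_realPart_le l)
  have hη : 0 ≤ δ * k := mul_nonneg hT.width_nonneg k.cast_nonneg
  induction i using Fin.lastCases with
  | last =>
    induction j using Fin.lastCases with
    | last =>
      rw [Ring.lie_def, sub_self, norm_zero]
      linarith [hT.width_nonneg]
    | cast l =>
      rw [norm_lie_comm]
      simpa only [weightedCoeff, Fin.snoc_castSucc, Fin.snoc_last] using hlast l
  | cast l =>
    induction j using Fin.lastCases with
    | last => simpa only [weightedCoeff, Fin.snoc_castSucc, Fin.snoc_last] using hlast l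
    | cast m =>
      simp only [weightedCoeff, Fin.snoc_castSucc]
      have hle := norm_lie_mul_mul_le hw (commute_weight (hpi l) a b) (commute_weight (hpi m) a b)
      linarith [hT.norm_lie_imaginaryPart_imaginaryPart_le l m]

theorem IsFuzzyTorus.algebraMap_le_cliffordSum_weightedCoeff_mul_self (hT : IsFuzzyTorus δ T)
    (hp : IsStarProjection p) (hTp : ∀ j, Commute p (T j)) (ha : 0 ≤ a) (hb : 0 ≤ b)
    (hab : a + b = 1) {γ : Fin (k + 1) → Matrix (Fin n) (Fin n) ℂ} (hγ : IsClifford γ) :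
    algebraMap ℝ (CStarMatrix (Fin n) (Fin n) E) (1 - 37 * (k + 1) ^ 3 * δ) ≤
      cliffordSum (weightedCoeff p a b T) γ * cliffordSum (weightedCoeff p a b T) γ := by
  obtain ⟨c, hc, hsum⟩ := hT.exists_nonneg_norm_sum_sq_sub_le hp hTp ha hb hab
  set y := weightedCoeff p a b T with hy
  have hsum_y : ‖∑ i, y i * y i - (1 + c)‖ ≤ 25 * k ^ 2 * δ := by
    simpa only [hy, weightedCoeff, Fin.sum_univ_castSucc, Fin.snoc_castSucc, Fin.snoc_last]
      using hsum
  have hy_self (i) : IsSelfAdjoint (y i) := by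
    rw [hy, ← smul_gCoeff_add_smul_restrictedCoeff hp hTp hab]
    exact ((IsSelfAdjoint.all a).smul
      (isSelfAdjoint_gCoeff (isSelfAdjoint_two_mul_sub_one hp.isSelfAdjoint) T i)).add
        ((IsSelfAdjoint.all b).smul (isSelfAdjoint_restrictedCoeff hp.isSelfAdjoint T i))
  have hM := isSelfAdjoint_cliffordSum hγ.isHermitian hy_self
  have hone : algebraMap ℝ (CStarMatrix (Fin n) (Fin n) E) 1 ≤ tensOne E n (1 + c) := by
    rw [map_one, map_add, map_one]
    exact le_add_of_nonneg_right (map_nonneg _ hc)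
  refine algebraMap_sub_le_of_norm_sub_le (.of_nonneg (IsSelfAdjoint.mul_self_nonneg hM))
    (IsSelfAdjoint.map ((IsSelfAdjoint.one E).add (.of_nonneg hc)) (tensOne E n)) hone ?_
  have h₁ := norm_cliffordSum_mul_self_sub_le hγ
    (hT.norm_lie_weightedCoeff_le hp hTp ha hb hab)
  have h₂ : ‖tensOne E n (∑ i, y i * y i) - tensOne E n (1 + c)‖ ≤ 25 * k ^ 2 * δ := by
    rw [← map_sub]
    exact (NonUnitalStarAlgHom.norm_apply_le (tensOne E n) _).trans hsum_y
  refine (norm_sub_le_norm_sub_add_norm_sub _ _ _).trans ((add_le_add h₁ h₂).trans ?_)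
  have hk : (k : ℝ) ^ 2 ≤ (k + 1) ^ 3 := by nlinarith [k.cast_nonneg (α := ℝ), sq_nonneg (k : ℝ)]
  push_cast
  nlinarith [mul_le_mul_of_nonneg_right hk hT.width_nonneg]

end Coefficients

section DiagonalPart

variable {E : Type*} [CStarAlgebra E] {d : ℕ} {δ ρ : ℝ} {p : E}

/-- The block diagonal part `p x p + (1 - p) x (1 - p)` of `x` with respect to a projection `p`. -/
def diagPart (p : E) : E →ₗ[ℂ] E :=
  LinearMap.mulLeftRight ℂ (p, p) + LinearMap.mulLeftRight ℂ (1 - p, 1 - p)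

theorem diagPart_apply (p x : E) : diagPart p x = p * x * p + (1 - p) * x * (1 - p) := rfl

theorem mul_diagPart (hp : IsIdempotentElem p) (x : E) : p * diagPart p x = p * x * p := by
  rw [diagPart_apply, mul_add, mul_assoc (1 - p), ← mul_assoc p (1 - p), hp.mul_one_sub_self,
    zero_mul, add_zero, ← mul_assoc, ← mul_assoc, hp.eq]

theorem diagPart_mul (hp : IsIdempotentElem p) (x : E) : diagPart p x * p = p * x * p := by
  rw [diagPart_apply, add_mul, mul_assoc _ (1 - p) p, hp.one_sub_mul_self, mul_zero, add_zero,
    mul_assoc, hp.eq]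

theorem commute_diagPart (hp : IsIdempotentElem p) (x : E) : Commute p (diagPart p x) :=
  (mul_diagPart hp x).trans (diagPart_mul hp x).symm

theorem mul_diagPart_mul (hp : IsIdempotentElem p) (x : E) :
    p * diagPart p x * p = p * x * p := by
  rw [mul_diagPart hp, mul_assoc, hp.eq]

theorem diagPart_one (hp : IsIdempotentElem p) : diagPart p 1 = 1 := by
  rw [diagPart_apply, mul_one, mul_one, hp.eq, hp.one_sub.eq, add_sub_cancel]

theorem star_diagPart (hp : IsSelfAdjoint p) (x : E) :
    star (diagPart p x) = diagPart p (star x) := by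
  simp only [diagPart_apply, star_add, star_mul, star_sub, star_one, hp.star_eq, mul_assoc]

theorem realPart_diagPart (hp : IsSelfAdjoint p) (x : E) :
    (ℜ (diagPart p x) : E) = diagPart p (ℜ x) := by
  rw [realPart_apply_coe, realPart_apply_coe, star_diagPart hp, ← map_add,
    LinearMap.map_smul_of_tower]

theorem imaginaryPart_diagPart (hp : IsSelfAdjoint p) (x : E) :
    (ℑ (diagPart p x) : E) = diagPart p (ℑ x) := by
  rw [imaginaryPart_apply_coe, imaginaryPart_apply_coe, star_diagPart hp, ← map_sub,
    map_smul, LinearMap.map_smul_of_tower]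

theorem norm_two_mul_sub_one_le (hp : IsStarProjection p) : ‖2 * p - 1‖ ≤ 1 := by
  rw [← sq_le_one_iff₀ (norm_nonneg _),
    ← (isSelfAdjoint_two_mul_sub_one hp.isSelfAdjoint).norm_mul_self,
    two_mul_sub_one_mul_self hp.isIdempotentElem]
  exact (IsStarProjection.one E).norm_le

theorem two_smul_diagPart (p x : E) :
    (2 : ℝ) • diagPart p x = x + (2 * p - 1) * x * (2 * p - 1) := by
  rw [two_smul, diagPart_apply]
  noncomm_ring

theorem norm_diagPart_le (hp : IsStarProjection p) (x : E) : ‖diagPart p x‖ ≤ ‖x‖ := by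
  have hS := norm_two_mul_sub_one_le hp
  have h : ‖(2 : ℝ) • diagPart p x‖ ≤ ‖x‖ + 1 * ‖x‖ * 1 := by
    rw [two_smul_diagPart]
    exact norm_add_le_of_le le_rfl (norm_mul_le_of_le (norm_mul_le_of_le hS le_rfl) hS)
  rw [norm_smul, Real.norm_ofNat] at h
  linarith

theorem sub_diagPart (hp : IsIdempotentElem p) (x : E) :
    x - diagPart p x = ⁅x, p⁆ * (2 * p - 1) := by
  rw [Ring.lie_def, sub_mul, mul_assoc x, mul_two_mul_sub_one hp, diagPart_apply]
  noncomm_ring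

theorem norm_sub_diagPart_le (hp : IsStarProjection p) {x : E} (hx : ‖⁅x, p⁆‖ ≤ ρ) :
    ‖x - diagPart p x‖ ≤ ρ := by
  rw [sub_diagPart hp.isIdempotentElem]
  simpa only [mul_one] using norm_mul_le_of_le hx (norm_two_mul_sub_one_le hp)

theorem diagPart_mul_diagPart (hp : IsIdempotentElem p) (x y : E) :
    diagPart p x * diagPart p y =
      diagPart p (x * y) - (x - diagPart p x) * (y - diagPart p y) := by
  have hpp (z : E) : p * (p * z) = p * z := by rw [← mul_assoc, hp.eq]
  simp only [diagPart_apply, mul_add, add_mul, mul_sub, sub_mul, mul_one, one_mul, mul_assoc,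
    hpp]
  abel

theorem norm_diagPart_mul_star_sub_one_le (hp : IsStarProjection p) {x : E}
    (hx : ‖⁅x, p⁆‖ ≤ ρ) (h : ‖x * star x - 1‖ ≤ δ) :
    ‖diagPart p x * star (diagPart p x) - 1‖ ≤ δ + ρ ^ 2 := by
  have hD := norm_sub_diagPart_le hp hx
  have hD' : ‖star x - diagPart p (star x)‖ ≤ ρ := by
    rwa [← star_diagPart hp.isSelfAdjoint, ← star_sub, norm_star]
  have hone : diagPart p (x * star x) - 1 = diagPart p (x * star x - 1) := by
    rw [map_sub, diagPart_one hp.isIdempotentElem]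
  rw [star_diagPart hp.isSelfAdjoint, diagPart_mul_diagPart hp.isIdempotentElem, sub_right_comm,
    hone, sq]
  exact norm_sub_le_of_le ((norm_diagPart_le hp _).trans h) (norm_mul_le_of_le hD hD')

theorem norm_diagPart_commutator_le (hp : IsStarProjection p) {x y : E}
    (hx : ‖⁅x, p⁆‖ ≤ ρ) (hy : ‖⁅y, p⁆‖ ≤ ρ) (h : ‖x * y - y * x‖ ≤ δ) :
    ‖diagPart p x * diagPart p y - diagPart p y * diagPart p x‖ ≤ δ + 2 * ρ ^ 2 := by
  have hDx := norm_sub_diagPart_le hp hx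
  have hDy := norm_sub_diagPart_le hp hy
  rw [diagPart_mul_diagPart hp.isIdempotentElem, diagPart_mul_diagPart hp.isIdempotentElem,
    sub_sub_sub_comm, ← map_sub, two_mul, sq]
  exact norm_sub_le_of_le ((norm_diagPart_le hp _).trans h)
    (norm_sub_le_of_le (norm_mul_le_of_le hDx hDy) (norm_mul_le_of_le hDy hDx))

end DiagonalPart

section Tori

variable {E : Type*} [CStarAlgebra E] {d : ℕ} {δ δ' ρ : ℝ} {p : E} {T : Fin d → E}

theorem isUnit_of_norm_sub_one_lt {x : E} (h : ‖x - 1‖ < 1) : IsUnit x := by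
  simpa only [sub_sub_cancel] using
    isUnit_one_sub_of_norm_lt_one (x := 1 - x) (by rwa [norm_sub_rev])

theorem isUnit_of_norm_mul_star_sub_one_lt {x : E} (h : ‖x * star x - 1‖ < 1)
    (h' : ‖star x * x - 1‖ < 1) : IsUnit x := by
  obtain ⟨r, hr⟩ := (isUnit_of_norm_sub_one_lt h).exists_right_inv
  obtain ⟨l, hl⟩ := (isUnit_of_norm_sub_one_lt h').exists_left_inv
  exact isUnit_iff_exists_and_exists.2
    ⟨⟨star x * r, by rw [← mul_assoc, hr]⟩, ⟨l * star x, by rw [mul_assoc, hl]⟩⟩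

theorem isFuzzyTorus_of_norm_le (hδ : 0 ≤ δ) (hδ₁ : δ < 1)
    (h : ∀ j, ‖T j * star (T j) - 1‖ ≤ δ) (h' : ∀ j, ‖star (T j) * T j - 1‖ ≤ δ)
    (hcomm : ∀ j i, ‖T j * T i - T i * T j‖ ≤ δ) : IsFuzzyTorus δ T where
  width_nonneg := hδ
  width_lt_one := hδ₁
  mem_corner j := by rw [one_mul, mul_one]
  invertible j := by
    obtain ⟨u, hu⟩ := isUnit_of_norm_mul_star_sub_one_lt ((h j).trans_lt hδ₁) ((h' j).trans_lt hδ₁)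
    exact ⟨↑u⁻¹, by rw [one_mul, mul_one], by rw [← hu, u.mul_inv], by rw [← hu, u.inv_mul]⟩
  norm_mul_star := h
  norm_star_mul := h'
  norm_commutator := hcomm

theorem IsFuzzyTorusIn.mono {e : E} (hT : IsFuzzyTorusIn e δ T) (h : δ ≤ δ') (h₁ : δ' < 1) :
    IsFuzzyTorusIn e δ' T where
  width_nonneg := hT.width_nonneg.trans h
  width_lt_one := h₁
  mem_corner := hT.mem_corner
  invertible := hT.invertible
  norm_mul_star j := (hT.norm_mul_star j).trans h
  norm_star_mul j := (hT.norm_star_mul j).trans h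
  norm_commutator j i := (hT.norm_commutator j i).trans h

theorem IsFuzzyTorusIn.comp {e : E} (hT : IsFuzzyTorusIn e δ T) {k : ℕ} (ι : Fin k → Fin d) :
    IsFuzzyTorusIn e δ (T ∘ ι) where
  width_nonneg := hT.width_nonneg
  width_lt_one := hT.width_lt_one
  mem_corner j := hT.mem_corner (ι j)
  invertible j := hT.invertible (ι j)
  norm_mul_star j := hT.norm_mul_star (ι j)
  norm_star_mul j := hT.norm_star_mul (ι j)
  norm_commutator j i := hT.norm_commutator (ι j) (ι i)

theorem IsFuzzyTorus.diagPart (hT : IsFuzzyTorus δ T) (hp : IsStarProjection p)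
    (hρ : ∀ j, ‖⁅T j, p⁆‖ ≤ ρ) (h : δ + 2 * ρ ^ 2 ≤ δ') (h₁ : δ' < 1) :
    IsFuzzyTorus δ' fun j => diagPart p (T j) := by
  have h_sq : δ + ρ ^ 2 ≤ δ' := by linarith [sq_nonneg ρ]
  have hδ : 0 ≤ δ' := by linarith [sq_nonneg ρ, hT.width_nonneg]
  refine isFuzzyTorus_of_norm_le hδ h₁ (fun j => ?_) (fun j => ?_) fun j i => ?_
  · exact (norm_diagPart_mul_star_sub_one_le hp (hρ j) (hT.norm_mul_star j)).trans h_sq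
  · have hρ' : ‖⁅star (T j), p⁆‖ ≤ ρ := by
      rw [← hp.isSelfAdjoint.star_eq, norm_lie_star_star]
      exact hρ j
    have hstar : ‖star (T j) * star (star (T j)) - 1‖ ≤ δ := by
      rw [star_star]
      exact hT.norm_star_mul j
    have hD := norm_diagPart_mul_star_sub_one_le hp hρ' hstar
    rw [← star_diagPart hp.isSelfAdjoint, star_star] at hD
    exact hD.trans h_sq
  · exact (norm_diagPart_commutator_le hp (hρ j) (hρ i) (hT.norm_commutator j i)).trans h

theorem norm_conjugate_le (hp : IsStarProjection p) (x : E) : ‖p * x * p‖ ≤ ‖x‖ := by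
  simpa only [one_mul, mul_one] using
    norm_mul_le_of_le (norm_mul_le_of_le hp.norm_le le_rfl) hp.norm_le

theorem IsFuzzyTorus.compress (hT : IsFuzzyTorus δ T) (hp : IsStarProjection p)
    (hTp : ∀ j, Commute p (T j)) : IsFuzzyTorusIn p δ fun j => p * T j * p := by
  have hpp := hp.isIdempotentElem.eq
  have hmul {x y : E} (hy : Commute p y) : p * x * p * (p * y * p) = p * (x * y) * p := by
    rw [mul_assoc p y p, ← hy.eq, ← mul_assoc p p y, hpp, mul_assoc (p * x) p, ← mul_assoc p p y,
      hpp, hy.eq]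
    simp only [mul_assoc]
  have hsub (x : E) : p * x * p - p = p * (x - 1) * p := by
    rw [mul_sub, sub_mul, mul_one, hpp]
  have hstar (x : E) : star (p * x * p) = p * star x * p := by
    rw [star_mul, star_mul, hp.isSelfAdjoint.star_eq, mul_assoc]
  have hTp' (j) : Commute p (star (T j)) := commute_star_right hp.isSelfAdjoint (hTp j)
  refine ⟨hT.width_nonneg, hT.width_lt_one, fun j => ?_, fun j => ?_, fun j => ?_, fun j => ?_,
    fun j i => ?_⟩
  · rw [← mul_assoc, ← mul_assoc, hpp, mul_assoc, hpp]
  · obtain ⟨R, -, hTR, hRT⟩ := hT.invertible j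
    have hR : Commute p R := (hTp j).units_inv_right (u := ⟨T j, R, hTR, hRT⟩)
    refine ⟨p * R * p, ?_, ?_, ?_⟩
    · rw [← mul_assoc, ← mul_assoc, hpp, mul_assoc, hpp]
    · rw [hmul hR, hTR, mul_one, hpp]
    · rw [hmul (hTp j), hRT, mul_one, hpp]
  · rw [hstar, hmul (hTp' j), hsub]
    exact (norm_conjugate_le hp _).trans (hT.norm_mul_star j)
  · rw [hstar, hmul (hTp j), hsub]
    exact (norm_conjugate_le hp _).trans (hT.norm_star_mul j)
  · rw [hmul (hTp i), hmul (hTp j), ← sub_mul, ← mul_sub]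
    exact (norm_conjugate_le hp _).trans (hT.norm_commutator j i)

end Tori

section SpectralProjection

variable {E : Type*} [CStarAlgebra E] {δ : ℝ} {h : E}

theorem continuousOn_indicator_Ioi :
    ContinuousOn (Set.indicator (Set.Ioi (0 : ℝ)) fun _ => (1 : ℝ)) {0}ᶜ :=
  fun _ ht => (continuousOn_const.continuousAt_indicator
    (by rwa [frontier_Ioi])).continuousWithinAt

theorem spectrum_subset_compl_zero (hu : IsUnit h) : spectrum ℝ h ⊆ {0}ᶜ :=
  Set.subset_compl_singleton_iff.2 ((spectrum.zero_notMem_iff ℝ).2 hu)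

theorem isStarProjection_posProj (hu : IsUnit h) : IsStarProjection (posProj h) := by
  have hc := continuousOn_indicator_Ioi.mono (spectrum_subset_compl_zero hu)
  refine ⟨?_, IsSelfAdjoint.cfc⟩
  rw [IsIdempotentElem, posProj, ← cfc_mul _ _ h hc hc]
  refine congrArg (cfc · h) (funext fun t => ?_)
  simp only [← Set.inter_indicator_mul, Set.inter_self, mul_one]

theorem continuousOn_posProj : ContinuousOn (posProj (B := E)) {h | IsSelfAdjoint h ∧ IsUnit h} :=
  continuousOn_id.cfc_of_mem_nhdsSet (s := {0}ᶜ) _ (isOpen_compl_singleton.mem_nhdsSet.2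
    (Set.iUnion₂_subset fun _ hh => spectrum_subset_compl_zero hh.2))
    (fun _ hh => hh.1) continuousOn_indicator_Ioi

theorem abs_sub_one_le_abs_sq_sub_one {t : ℝ} (ht : 0 ≤ t) : |t - 1| ≤ |t ^ 2 - 1| := by
  rw [show t ^ 2 - 1 = (t + 1) * (t - 1) by ring, abs_mul]
  exact le_mul_of_one_le_left (abs_nonneg _) ((le_add_of_nonneg_left ht).trans (le_abs_self _))

theorem abs_sq_sub_one_le_of_mem_spectrum (hδ : ‖h * h - 1‖ ≤ δ) {t : ℝ}
    (ht : t ∈ spectrum ℝ h) : |t ^ 2 - 1| ≤ δ := by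
  have hmem : t ^ 2 - 1 ∈ spectrum ℝ (h * h - 1) := by
    rw [← sq, ← map_one (algebraMap ℝ E), ← spectrum.sub_singleton_eq]
    exact Set.sub_mem_sub (spectrum.pow_mem_pow h 2 ht) rfl
  calc |t ^ 2 - 1| ≤ ‖h * h - 1‖ * ‖(1 : E)‖ := spectrum.norm_le_norm_mul_of_mem hmem
    _ ≤ ‖h * h - 1‖ * 1 := by gcongr; exact (IsStarProjection.one E).norm_le
    _ ≤ δ := by rwa [mul_one]

theorem norm_sub_two_mul_posProj_sub_one_le (hsa : IsSelfAdjoint h) (hu : IsUnit h)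
    (hδ : ‖h * h - 1‖ ≤ δ) : ‖h - (2 * posProj h - 1)‖ ≤ δ := by
  have hc := continuousOn_indicator_Ioi.mono (spectrum_subset_compl_zero hu)
  set f := Set.indicator (Set.Ioi (0 : ℝ)) fun _ => (1 : ℝ)
  have hcfc : h - (2 * posProj h - 1) = cfc (fun t => t - (2 * f t - 1)) h := by
    rw [cfc_sub (fun t => t) (fun t => 2 * f t - 1) h continuousOn_id
      ((continuousOn_const.mul hc).sub continuousOn_const),
      cfc_sub (fun t => 2 * f t) (fun _ => 1) h (continuousOn_const.mul hc) continuousOn_const,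
      cfc_const_mul 2 f h hc, cfc_id' ℝ h, cfc_const_one ℝ h, posProj, two_smul, two_mul]
  rw [hcfc]
  refine norm_cfc_le ((norm_nonneg _).trans hδ) fun t ht => ?_
  refine le_trans ?_ (abs_sq_sub_one_le_of_mem_spectrum hδ ht)
  rw [Real.norm_eq_abs]
  rcases le_or_gt t 0 with hneg | hpos
  · rw [show f t = 0 from Set.indicator_of_notMem (Set.notMem_Ioi.2 hneg) _,
      show t - (2 * 0 - 1) = -(-t - 1) by ring, abs_neg, ← neg_sq t]
    exact abs_sub_one_le_abs_sq_sub_one (neg_nonneg.2 hneg)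
  · rw [show f t = 1 from Set.indicator_of_mem (Set.mem_Ioi.2 hpos) _,
      show t - (2 * 1 - 1) = t - 1 by ring]
    exact abs_sub_one_le_abs_sq_sub_one hpos.le

end SpectralProjection

section Interpolation

attribute [local instance] CStarAlgebra.spectralOrder CStarAlgebra.spectralOrderedRing

variable {E : Type*} [CStarAlgebra E] {k n : ℕ} {δ ρ σ a b : ℝ} {p h : E} {T : Fin k → E}
  {γ : Fin (k + 1) → Matrix (Fin n) (Fin n) ℂ}

theorem sum_one_sub_realPart_diagPart (hp : IsStarProjection p) (T : Fin k → E) :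
    ∑ j, (1 - ℜ (diagPart p (T j)) : E) = diagPart p (∑ j, (1 - ℜ (T j) : E)) := by
  simp only [map_sum, map_sub, diagPart_one hp.isIdempotentElem, realPart_diagPart hp.isSelfAdjoint]

theorem restrictedCoeff_diagPart (hp : IsStarProjection p) (T : Fin k → E) :
    restrictedCoeff p (fun j => diagPart p (T j)) = restrictedCoeff p T := by
  simp only [restrictedCoeff, sum_one_sub_realPart_diagPart hp,
    imaginaryPart_diagPart hp.isSelfAdjoint, mul_diagPart_mul hp.isIdempotentElem]

theorem norm_cliffordSum_gCoeff_sub_le (hγ : IsClifford γ) {h' : E} {T' : Fin k → E}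
    (hT : ∀ j, ‖T j - T' j‖ ≤ ρ) (hh : ‖h - h'‖ ≤ σ) :
    ‖cliffordSum (gCoeff h T) γ - cliffordSum (gCoeff h' T') γ‖ ≤ 2 * k * ρ + σ := by
  rw [← cliffordSum_sub]
  refine (norm_cliffordSum_le _ hγ).trans ?_
  have him (j : Fin k) : ‖(ℑ (T j) : E) - ℑ (T' j)‖ ≤ ρ := by
    rw [← AddSubgroupClass.coe_sub, ← map_sub]
    exact (imaginaryPart.norm_le _).trans (hT j)
  have hre (j : Fin k) : ‖(1 - ℜ (T j) : E) - (1 - ℜ (T' j))‖ ≤ ρ := by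
    rw [sub_sub_sub_cancel_left, norm_sub_rev, ← AddSubgroupClass.coe_sub, ← map_sub]
    exact (realPart.norm_le _).trans (hT j)
  have hlast : ‖∑ j, (1 - ℜ (T j) : E) - h - (∑ j, (1 - ℜ (T' j) : E) - h')‖ ≤ k * ρ + σ := by
    rw [sub_sub_sub_comm, ← Finset.sum_sub_distrib]
    simpa using norm_sub_le_of_le (norm_sum_le_of_le Finset.univ fun j _ => hre j) hh
  have hsum := Finset.sum_le_sum fun j (_ : j ∈ Finset.univ) => him j
  simp only [Finset.sum_const, Finset.card_univ, Fintype.card_fin, nsmul_eq_mul] at hsum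
  simp only [Fin.sum_univ_castSucc, Pi.sub_apply, gCoeff, Fin.snoc_castSucc, Fin.snoc_last]
  linarith

theorem norm_lie_proj_le {x : E} (hx : ‖x‖ ≤ 2) (hxh : ‖⁅x, h⁆‖ ≤ δ)
    (hh : ‖h - (2 * p - 1)‖ ≤ δ) : ‖⁅x, p⁆‖ ≤ 5 / 2 * δ := by
  have hsplit : (2 : ℝ) • ⁅x, p⁆ =
      ⁅x, h⁆ - (x * (h - (2 * p - 1)) - (h - (2 * p - 1)) * x) := by
    simp only [Ring.lie_def, two_smul]
    noncomm_ring
  have hnorm := norm_sub_le_of_le hxh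
    (norm_sub_le_of_le (norm_mul_le_of_le hx hh) (norm_mul_le_of_le hh hx))
  rw [← hsplit, norm_smul, Real.norm_ofNat] at hnorm
  linarith

theorem isSelfAdjoint_smul_cliffordSum_add (hp : IsSelfAdjoint p) (hh : IsSelfAdjoint h)
    (T T' : Fin k → E) (hγ : IsClifford γ) (a b : ℝ) :
    IsSelfAdjoint (a • cliffordSum (gCoeff h T) γ + b • cliffordSum (restrictedCoeff p T') γ) :=
  ((IsSelfAdjoint.all a).smul
    (isSelfAdjoint_cliffordSum hγ.isHermitian (isSelfAdjoint_gCoeff hh T))).add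
      ((IsSelfAdjoint.all b).smul
        (isSelfAdjoint_cliffordSum hγ.isHermitian (isSelfAdjoint_restrictedCoeff hp T')))

theorem IsFuzzyTorus.algebraMap_le_smul_cliffordSum_add_mul_self (hT : IsFuzzyTorus δ T)
    (hp : IsStarProjection p) (hTp : ∀ j, Commute p (T j)) (hγ : IsClifford γ) (ha : 0 ≤ a)
    (hb : 0 ≤ b) (hab : a + b = 1) :
    algebraMap ℝ (CStarMatrix (Fin n) (Fin n) E) (1 - 37 * (k + 1) ^ 3 * δ) ≤
      (a • cliffordSum (gCoeff (2 * p - 1) T) γ + b • cliffordSum (restrictedCoeff p T) γ) *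
        (a • cliffordSum (gCoeff (2 * p - 1) T) γ + b • cliffordSum (restrictedCoeff p T) γ) := by
  rw [← cliffordSum_smul, ← cliffordSum_smul, ← cliffordSum_add,
    smul_gCoeff_add_smul_restrictedCoeff hp hTp hab]
  exact hT.algebraMap_le_cliffordSum_weightedCoeff_mul_self hp hTp ha hb hab hγ

theorem IsFuzzyTorus.isUnit_smul_cliffordSum_add (hT : IsFuzzyTorus δ T) (hp : IsStarProjection p)
    (hh : IsSelfAdjoint h) (hhp : ‖h - (2 * p - 1)‖ ≤ δ) (hTh : ∀ j, ‖⁅T j, h⁆‖ ≤ δ)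
    (hδ : 100 * (k + 1) ^ 3 * δ ≤ 1) (hγ : IsClifford γ) (ha : 0 ≤ a) (hb : 0 ≤ b)
    (hab : a + b = 1) :
    IsUnit (a • cliffordSum (gCoeff h T) γ + b • cliffordSum (restrictedCoeff p T) γ) := by
  have hδ₀ := hT.width_nonneg
  have hk : (0 : ℝ) ≤ k := k.cast_nonneg
  have hk₁ : (k + 1 : ℝ) * δ ≤ (k + 1) ^ 3 * δ := by
    gcongr; exact le_self_pow₀ (by linarith) (by norm_num)
  have hδ_le : δ ≤ 1 / 100 := by nlinarith [mul_nonneg hk hδ₀]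
  have hTp (j : Fin k) : ‖⁅T j, p⁆‖ ≤ 5 / 2 * δ := norm_lie_proj_le (hT.norm_le_two j) (hTh j) hhp
  set D : Fin k → E := fun j => FuzzyTorus.diagPart p (T j) with hD
  have hlower := (hT.diagPart hp hTp (δ' := 2 * δ) (by nlinarith)
    (by linarith)).algebraMap_le_smul_cliffordSum_add_mul_self hp
      (fun j => commute_diagPart hp.isIdempotentElem _) hγ ha hb hab
  rw [restrictedCoeff_diagPart hp, ← hD] at hlower
  refine isUnit_of_norm_sub_le (isSelfAdjoint_smul_cliffordSum_add hp.isSelfAdjoint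
    (isSelfAdjoint_two_mul_sub_one hp.isSelfAdjoint) D T hγ a b)
    (isSelfAdjoint_smul_cliffordSum_add hp.isSelfAdjoint hh T T hγ a b) hlower (r := 1 / 20) ?_
    (by linarith)
  have hdist : ‖cliffordSum (gCoeff h T) γ - cliffordSum (gCoeff (2 * p - 1) D) γ‖ ≤
      2 * k * (5 / 2 * δ) + δ :=
    norm_cliffordSum_gCoeff_sub_le hγ (fun j => norm_sub_diagPart_le hp (hTp j)) hhp
  rw [add_sub_add_right_eq_sub, ← smul_sub]
  change ‖(a : ℂ) • (cliffordSum (gCoeff h T) γ - cliffordSum (gCoeff (2 * p - 1) D) γ)‖ ≤ _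
  rw [norm_smul, Complex.norm_of_nonneg ha]
  exact (mul_le_of_le_one_left (norm_nonneg _) (by linarith)).trans (by linarith)

end Interpolation

section GradedTori

variable {E : Type*} [CStarAlgebra E] {d n : ℕ} {δ : ℝ} {T : Fin (d + 1) → E}

theorem IsFuzzyTorus.isUnit {T : Fin d → E} (hT : IsFuzzyTorus δ T) (j : Fin d) :
    IsUnit (T j) := by
  obtain ⟨R, -, hTR, hRT⟩ := hT.invertible j
  exact ⟨⟨T j, R, hTR, hRT⟩, rfl⟩

theorem IsGradedFuzzyTorus.isStarProjection_gradingProj (hT : IsGradedFuzzyTorus δ T) :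
    IsStarProjection (gradingProj T) :=
  isStarProjection_posProj (hT.2.isUnit _)

theorem IsGradedFuzzyTorus.norm_last_sub_le (hT : IsGradedFuzzyTorus δ T) :
    ‖T (Fin.last d) - (2 * gradingProj T - 1)‖ ≤ δ := by
  refine norm_sub_two_mul_posProj_sub_one_le hT.1 (hT.2.isUnit _) ?_
  simpa only [hT.1.star_eq] using hT.2.norm_star_mul (Fin.last d)

theorem IsGradedFuzzyTorus.isFuzzyTorusIn_restrictedTorus (hT : IsGradedFuzzyTorus δ T)
    (hδ : 100 * δ ≤ 1) : IsFuzzyTorusIn (gradingProj T) (6 * δ) (restrictedTorus T) := by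
  have hδ₀ := hT.2.width_nonneg
  have hp := hT.isStarProjection_gradingProj
  have hTp (j : Fin d) : ‖⁅T j.castSucc, gradingProj T⁆‖ ≤ 5 / 2 * δ :=
    norm_lie_proj_le (hT.2.norm_le_two _) (hT.2.norm_commutator _ _) hT.norm_last_sub_le
  have hD : IsFuzzyTorus (2 * δ) fun j : Fin d => diagPart (gradingProj T) (T j.castSucc) :=
    IsFuzzyTorus.diagPart (IsFuzzyTorusIn.comp hT.2 Fin.castSucc) hp hTp (by nlinarith)
      (by linarith)
  have hPDP := (hD.compress hp fun j => commute_diagPart hp.isIdempotentElem _).mono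
    (δ' := 6 * δ) (by linarith) (by linarith)
  simp only [mul_diagPart_mul hp.isIdempotentElem] at hPDP
  exact hPDP

theorem gOp_one_eq_cliffordSum (T : Fin d → E) (I : Finset (Fin d))
    (γ : Fin (I.card + 1) → Matrix (Fin n) (Fin n) ℂ) :
    gOp 1 T I γ = cliffordSum (gCoeff 1 (T ∘ I.orderEmbOfFin rfl)) γ := by
  simp only [gOp, cliffordSum, gCoeff, Fin.sum_univ_castSucc, Fin.snoc_castSucc, Fin.snoc_last,
    Function.comp_apply, Finset.sum_sub_distrib, Finset.sum_const, Finset.card_univ,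
    Fintype.card_fin, sub_smul, one_smul, Nat.cast_smul_eq_nsmul, sub_right_comm]

theorem gHatOp_eq_cliffordSum (T : Fin (d + 1) → E) (I : Finset (Fin d))
    (γ : Fin (I.card + 1) → Matrix (Fin n) (Fin n) ℂ) :
    gHatOp T I γ =
      cliffordSum (gCoeff (T (Fin.last d)) (T ∘ Fin.castSucc ∘ I.orderEmbOfFin rfl)) γ := by
  simp only [gHatOp, cliffordSum, gCoeff, Fin.sum_univ_castSucc, Fin.snoc_castSucc, Fin.snoc_last,
    Function.comp_apply, Finset.sum_sub_distrib, Finset.sum_const, Finset.card_univ,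
    Fintype.card_fin, Nat.cast_smul_eq_nsmul]

theorem realPart_conjugate {p : E} (hp : IsSelfAdjoint p) (x : E) :
    (ℜ (p * x * p) : E) = p * ℜ x * p := by
  rw [realPart_apply_coe, realPart_apply_coe, star_mul, star_mul, hp.star_eq, mul_smul_comm,
    smul_mul_assoc, mul_add, add_mul, mul_assoc p (star x)]

theorem imaginaryPart_conjugate {p : E} (hp : IsSelfAdjoint p) (x : E) :
    (ℑ (p * x * p) : E) = p * ℑ x * p := by
  rw [imaginaryPart_apply_coe, imaginaryPart_apply_coe, star_mul, star_mul, hp.star_eq]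
  simp only [mul_smul_comm, smul_mul_assoc, mul_sub, sub_mul, mul_assoc]

theorem gRestrictedOp_eq_cliffordSum (hp : IsStarProjection (gradingProj T)) (I : Finset (Fin d))
    (γ : Fin (I.card + 1) → Matrix (Fin n) (Fin n) ℂ) :
    gRestrictedOp T I γ =
      cliffordSum (restrictedCoeff (gradingProj T) (T ∘ Fin.castSucc ∘ I.orderEmbOfFin rfl)) γ := by
  simp only [gRestrictedOp, gOp, restrictedTorus, cliffordSum, restrictedCoeff,
    Fin.sum_univ_castSucc, Fin.snoc_castSucc, Fin.snoc_last, Function.comp_apply,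
    realPart_conjugate hp.isSelfAdjoint, imaginaryPart_conjugate hp.isSelfAdjoint, add_assoc,
    ← tens_add_left]
  congr 2
  simp only [Finset.sum_sub_distrib, Finset.sum_const, Finset.card_univ, Fintype.card_fin, mul_sub,
    sub_mul, Finset.mul_sum, Finset.sum_mul, mul_smul_comm, smul_mul_assoc, mul_one,
    hp.isIdempotentElem.eq, sub_smul, one_smul, Nat.cast_smul_eq_nsmul, two_mul]
  abel

end GradedTori

section GOperators

variable {E : Type*} [CStarAlgebra E] {d n : ℕ} {δ : ℝ} {I : Finset (Fin d)}
  {γ : Fin (I.card + 1) → Matrix (Fin n) (Fin n) ℂ} {Γ : Matrix (Fin n) (Fin n) ℂ}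

theorem isSelfAdjoint_gOp_one (T : Fin d → E) (hγ : ∀ i, (γ i).IsHermitian) :
    IsSelfAdjoint (gOp 1 T I γ) := by
  rw [gOp_one_eq_cliffordSum]
  exact isSelfAdjoint_cliffordSum hγ (isSelfAdjoint_gCoeff (.one E) _)

theorem scal_mul_gOp_one (T : Fin d → E) (hΓ : ∀ i, Γ * γ i = -(γ i * Γ)) :
    scal E Γ * gOp 1 T I γ = -(gOp 1 T I γ * scal E Γ) := by
  rw [gOp_one_eq_cliffordSum, scal_mul_cliffordSum _ hΓ]

theorem card_add_one_pow_mul_le (hδ₀ : 0 ≤ δ) (hδ : 100 * (d + 1) ^ 3 * δ ≤ 1)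
    (I : Finset (Fin d)) : 100 * (I.card + 1) ^ 3 * δ ≤ 1 := by
  refine le_trans ?_ hδ
  gcongr
  exact card_finset_fin_le I

theorem IsFuzzyTorus.isUnit_gOp_one {T : Fin d → E} (hT : IsFuzzyTorus δ T)
    (hδ : 100 * (d + 1) ^ 3 * δ ≤ 1) (hγ : IsClifford γ) : IsUnit (gOp 1 T I γ) := by
  have hTI : IsFuzzyTorus δ (T ∘ I.orderEmbOfFin rfl) := IsFuzzyTorusIn.comp hT _
  have hunit := hTI.isUnit_smul_cliffordSum_add (p := 1) (h := 1) (a := 1) (b := 0) (.one E)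
    (.one E) (by norm_num [hT.width_nonneg]) (by simp [Ring.lie_def, hT.width_nonneg])
    (card_add_one_pow_mul_le hT.width_nonneg hδ I) hγ zero_le_one le_rfl (add_zero 1)
  rwa [one_smul, zero_smul, add_zero, ← gOp_one_eq_cliffordSum] at hunit

variable {T : Fin (d + 1) → E}

theorem isSelfAdjoint_gHatOp (hT : IsSelfAdjoint (T (Fin.last d)))
    (hγ : ∀ i, (γ i).IsHermitian) : IsSelfAdjoint (gHatOp T I γ) := by
  rw [gHatOp_eq_cliffordSum]
  exact isSelfAdjoint_cliffordSum hγ (isSelfAdjoint_gCoeff hT _)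

theorem isSelfAdjoint_gRestrictedOp (hp : IsStarProjection (gradingProj T))
    (hγ : ∀ i, (γ i).IsHermitian) : IsSelfAdjoint (gRestrictedOp T I γ) := by
  rw [gRestrictedOp_eq_cliffordSum hp]
  exact isSelfAdjoint_cliffordSum hγ (isSelfAdjoint_restrictedCoeff hp.isSelfAdjoint _)

theorem scal_mul_gHatOp (T : Fin (d + 1) → E) (hΓ : ∀ i, Γ * γ i = -(γ i * Γ)) :
    scal E Γ * gHatOp T I γ = -(gHatOp T I γ * scal E Γ) := by
  rw [gHatOp_eq_cliffordSum, scal_mul_cliffordSum _ hΓ]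

theorem scal_mul_gRestrictedOp (hp : IsStarProjection (gradingProj T))
    (hΓ : ∀ i, Γ * γ i = -(γ i * Γ)) :
    scal E Γ * gRestrictedOp T I γ = -(gRestrictedOp T I γ * scal E Γ) := by
  rw [gRestrictedOp_eq_cliffordSum hp, scal_mul_cliffordSum _ hΓ]

theorem IsGradedFuzzyTorus.isUnit_smul_gHatOp_add (hT : IsGradedFuzzyTorus δ T)
    (hδ : 100 * (d + 1) ^ 3 * δ ≤ 1) (hγ : IsClifford γ) {a b : ℝ} (ha : 0 ≤ a) (hb : 0 ≤ b)
    (hab : a + b = 1) : IsUnit (a • gHatOp T I γ + b • gRestrictedOp T I γ) := by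
  have hTI : IsFuzzyTorus δ (T ∘ Fin.castSucc ∘ I.orderEmbOfFin rfl) :=
    IsFuzzyTorusIn.comp hT.2 _
  rw [gHatOp_eq_cliffordSum, gRestrictedOp_eq_cliffordSum hT.isStarProjection_gradingProj]
  exact hTI.isUnit_smul_cliffordSum_add hT.isStarProjection_gradingProj hT.1 hT.norm_last_sub_le
    (fun _ => hT.2.norm_commutator _ _) (card_add_one_pow_mul_le hT.2.width_nonneg hδ I) hγ ha hb
    hab

theorem IsGradedFuzzyTorus.joinedIn_gHatOp_gRestrictedOp (hT : IsGradedFuzzyTorus δ T)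
    (hδ : 100 * (d + 1) ^ 3 * δ ≤ 1) (hγ : IsClifford γ) :
    JoinedIn {h : CStarMatrix (Fin n) (Fin n) E | IsSelfAdjoint h ∧ IsUnit h ∧
        ∀ Γ, (∀ i, Γ * γ i = -(γ i * Γ)) → scal E Γ * h = -(h * scal E Γ)}
      (gHatOp T I γ) (gRestrictedOp T I γ) := by
  have hp := hT.isStarProjection_gradingProj
  refine JoinedIn.of_segment_subset ?_
  rintro _ ⟨a, b, ha, hb, hab, rfl⟩
  refine ⟨((IsSelfAdjoint.all a).smul (isSelfAdjoint_gHatOp hT.1 hγ.isHermitian)).add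
    ((IsSelfAdjoint.all b).smul (isSelfAdjoint_gRestrictedOp hp hγ.isHermitian)),
    hT.isUnit_smul_gHatOp_add hδ hγ ha hb hab, fun Γ hΓ => ?_⟩
  rw [mul_add, add_mul, mul_smul_comm, mul_smul_comm, scal_mul_gHatOp T hΓ,
    scal_mul_gRestrictedOp hp hΓ, smul_mul_assoc, smul_mul_assoc, smul_neg, smul_neg, neg_add]

end GOperators

section VolumeElement

variable {R : Type*} [Ring R] {l : List R}

theorem list_prod_mul_eq_of_anticommute {x : R} (h : ∀ y ∈ l, y * x = -(x * y)) :
    l.prod * x = (-1) ^ l.length * (x * l.prod) := by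
  induction l with
  | nil => simp
  | cons y t ih =>
    rw [List.forall_mem_cons] at h
    rw [List.prod_cons, mul_assoc, ih h.2, List.length_cons, pow_succ, ← mul_assoc y,
      ((Commute.neg_one_right y).pow_right _).eq, mul_assoc, ← mul_assoc y, h.1]
    noncomm_ring

theorem list_prod_mul_eq_of_mem (hsq : ∀ y ∈ l, y * y = 1)
    (ha : l.Pairwise fun y z => y * z = -(z * y)) {x : R} (hx : x ∈ l) :
    l.prod * x = (-1) ^ (l.length + 1) * (x * l.prod) := by
  induction l with
  | nil => exact absurd hx List.not_mem_nil
  | cons y t ih =>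
    rw [List.forall_mem_cons] at hsq
    rw [List.pairwise_cons] at ha
    rw [List.prod_cons, List.length_cons]
    rcases List.mem_cons.1 hx with rfl | hxt
    · rw [mul_assoc, list_prod_mul_eq_of_anticommute fun z hz => by rw [ha.1 z hz, neg_neg],
        ← mul_assoc x x, hsq.1, ← mul_assoc, ((Commute.neg_one_right x).pow_right _).eq, mul_assoc,
        ← mul_assoc x x, hsq.1, one_mul, add_assoc, pow_add _ _ (1 + 1), one_add_one_eq_two,
        neg_one_sq, mul_one]
    · rw [mul_assoc, ih hsq.2 ha.2 hxt, ← mul_assoc y, ((Commute.neg_one_right y).pow_right _).eq,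
        mul_assoc, ← mul_assoc y, ha.1 x hxt, pow_succ]
      noncomm_ring

theorem star_list_prod_eq_or_eq_neg [StarRing R] (hl : ∀ y ∈ l, IsSelfAdjoint y)
    (ha : l.Pairwise fun y z => y * z = -(z * y)) :
    star l.prod = l.prod ∨ star l.prod = -l.prod := by
  induction l with
  | nil => exact .inl (by simp)
  | cons y t ih =>
    rw [List.forall_mem_cons] at hl
    rw [List.pairwise_cons] at ha
    have hswap : t.prod * y = (-1) ^ t.length * (y * t.prod) :=
      list_prod_mul_eq_of_anticommute fun z hz => by rw [ha.1 z hz, neg_neg]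
    rw [List.prod_cons, star_mul, hl.1.star_eq]
    rcases neg_one_pow_eq_or R t.length with hs | hs <;> rcases ih hl.2 ha.2 with ht | ht <;>
      simp [hswap, hs, ht]

theorem IsClifford.exists_isFurtherGenerator {k n : ℕ} {γ : Fin k → Matrix (Fin n) (Fin n) ℂ}
    (hγ : IsClifford γ) (hk : Even k) : ∃ Γ, IsFurtherGenerator γ Γ := by
  have hanti : (List.ofFn γ).Pairwise fun y z => y * z = -(z * y) :=
    List.pairwise_ofFn.2 fun i j hij => hγ.anticommute i j hij.ne
  have hunitary : (List.ofFn γ).prod ∈ unitary (Matrix (Fin n) (Fin n) ℂ) :=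
    list_prod_mem (List.forall_mem_ofFn_iff.2 fun i => Matrix.mem_unitaryGroup_iff'.2
      (hγ.conjTranspose_mul_self i))
  have hmul : ∀ i, (List.ofFn γ).prod * γ i = -(γ i * (List.ofFn γ).prod) := fun i => by
    rw [list_prod_mul_eq_of_mem (List.forall_mem_ofFn_iff.2 hγ.sq_eq_one) hanti
      (List.mem_ofFn.2 ⟨i, rfl⟩), List.length_ofFn, hk.add_one.neg_one_pow, neg_one_mul]
  have hstar := star_list_prod_eq_or_eq_neg
    (List.forall_mem_ofFn_iff.2 fun i => (hγ.isHermitian i).isSelfAdjoint) hanti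
  generalize (List.ofFn γ).prod = ω at hunitary hmul hstar
  have hω := Unitary.star_mul_self_of_mem hunitary
  rcases hstar with hstar | hstar
  · exact ⟨ω, hstar, by rwa [hstar] at hω, hmul⟩
  · refine ⟨Complex.I • ω, ?_, ?_, fun i => ?_⟩
    · rw [Matrix.IsHermitian, Matrix.conjTranspose_smul, ← Matrix.star_eq_conjTranspose, hstar]
      simp
    · rwa [smul_mul_smul_comm, Complex.I_mul_I, neg_one_smul, ← neg_mul, ← hstar]
    · rw [smul_mul_assoc, hmul, mul_smul_comm, smul_neg]

end VolumeElement

section Eigenbasis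

theorem exists_isometry_mul_conjTranspose_eq {ι 𝕜 : Type*} [Fintype ι] [RCLike 𝕜]
    {p : Matrix ι ι 𝕜} (hp : IsStarProjection p) :
    ∃ (m : ℕ) (S : Matrix ι (Fin m) 𝕜), Sᴴ * S = 1 ∧ S * Sᴴ = p := by
  classical
  have hh : p.IsHermitian := hp.isSelfAdjoint
  set U : Matrix ι ι 𝕜 := hh.eigenvectorUnitary.1
  have hU : Uᴴ * U = 1 := Unitary.star_mul_self_of_mem hh.eigenvectorUnitary.2
  have hspectral : p = U * Matrix.diagonal (RCLike.ofReal ∘ hh.eigenvalues) * Uᴴ :=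
    hh.spectral_theorem
  have heigenvalues : ∀ i, hh.eigenvalues i = 0 ∨ hh.eigenvalues i = 1 := fun i =>
    hp.isIdempotentElem.spectrum_subset ℝ (hh.eigenvalues_mem_spectrum_real i)
  let e := (Fintype.equivFin {i // hh.eigenvalues i = 1}).symm
  refine ⟨_, U.submatrix id (Subtype.val ∘ e), ?_, ?_⟩
  · rw [Matrix.conjTranspose_submatrix, ← Matrix.submatrix_mul _ _ _ _ _ Function.bijective_id, hU,
      Matrix.submatrix_one _ (Subtype.val_injective.comp e.injective)]
  · ext i j
    conv_rhs => rw [hspectral]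
    simp only [Matrix.mul_apply (M := U.submatrix _ _), Matrix.mul_apply (N := Uᴴ),
      Matrix.mul_diagonal, Function.comp_apply, Matrix.submatrix_apply,
      Matrix.conjTranspose_apply, id]
    rw [e.sum_comp (fun x : {i // hh.eigenvalues i = 1} => U i x * star (U j x)),
      ← Finset.sum_subtype (Finset.univ.filter fun i => hh.eigenvalues i = 1) (by simp)
        (fun x => U i x * star (U j x)), Finset.sum_filter]
    refine Finset.sum_congr rfl fun x _ => ?_
    rcases heigenvalues x with h | h <;> simp [h]

variable {m n : ℕ} {Γ : Matrix (Fin n) (Fin n) ℂ} {S T : Matrix (Fin n) (Fin m) ℂ}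

/-- The columns of `S` and of `T` are orthonormal bases of the eigenspaces of the symmetry `Γ` for
the eigenvalues `1` and `-1`, which have the same dimension `m`. -/
structure IsEigenbasis (Γ : Matrix (Fin n) (Fin n) ℂ) (S T : Matrix (Fin n) (Fin m) ℂ) : Prop where
  isometry_left : Sᴴ * S = 1
  isometry_right : Tᴴ * T = 1
  add_eq_one : S * Sᴴ + T * Tᴴ = 1
  sub_eq : S * Sᴴ - T * Tᴴ = Γ

theorem IsEigenbasis.left_mul_conjTranspose (h : IsEigenbasis Γ S T) :
    S * Sᴴ = (1 / 2 : ℂ) • (1 + Γ) := by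
  rw [← h.add_eq_one, ← h.sub_eq]
  module

theorem IsEigenbasis.right_mul_conjTranspose (h : IsEigenbasis Γ S T) :
    T * Tᴴ = (1 / 2 : ℂ) • (1 - Γ) := by
  rw [← h.add_eq_one, ← h.sub_eq]
  module

theorem IsEigenbasis.add_self_eq (h : IsEigenbasis Γ S T) : m + m = n := by
  have htrace := congrArg Matrix.trace h.add_eq_one
  rw [Matrix.trace_add, Matrix.trace_mul_comm S, Matrix.trace_mul_comm T, h.isometry_left,
    h.isometry_right] at htrace
  simp only [Matrix.trace_one, Fintype.card_fin] at htrace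
  exact_mod_cast htrace

theorem isStarProjection_half_smul_one_add (hΓ : Γ.IsHermitian) (hsq : Γ * Γ = 1) :
    IsStarProjection ((1 / 2 : ℂ) • (1 + Γ)) := by
  refine ⟨?_, ?_⟩
  · rw [IsIdempotentElem, smul_mul_smul_comm, add_mul, mul_add, mul_add, hsq]
    simp only [one_mul, mul_one]
    module
  · rw [isSelfAdjoint_iff, star_smul, star_add, star_one, Matrix.star_eq_conjTranspose, hΓ.eq]
    simp

theorem exists_isEigenbasis_of_anticommute (hΓ : Γ.IsHermitian) (hsq : Γ * Γ = 1)
    {g : Matrix (Fin n) (Fin n) ℂ} (hg : g ∈ Matrix.unitaryGroup (Fin n) ℂ)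
    (ha : Γ * g = -(g * Γ)) :
    ∃ (m : ℕ) (S T : Matrix (Fin n) (Fin m) ℂ), IsEigenbasis Γ S T := by
  obtain ⟨m, S, hS, hSS⟩ := exists_isometry_mul_conjTranspose_eq
    (isStarProjection_half_smul_one_add hΓ hsq)
  have hgg : g * gᴴ = 1 := Matrix.mem_unitaryGroup_iff.1 hg
  have hgg' : gᴴ * g = 1 := Matrix.mem_unitaryGroup_iff'.1 hg
  have hTT : g * S * (g * S)ᴴ = (1 / 2 : ℂ) • (1 - Γ) := calc
    g * S * (g * S)ᴴ = g * (S * Sᴴ) * gᴴ := by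
      simp only [Matrix.conjTranspose_mul, Matrix.mul_assoc]
    _ = (1 / 2 : ℂ) • ((g + g * Γ) * gᴴ) := by
      rw [hSS, mul_smul_comm, smul_mul_assoc, mul_add, mul_one]
    _ = (1 / 2 : ℂ) • (1 - Γ) := by
      rw [← neg_eq_iff_eq_neg.2 ha, ← sub_eq_add_neg, sub_mul, mul_assoc Γ, hgg, mul_one]
  refine ⟨m, S, g * S, hS, ?_, by rw [hSS, hTT]; module, by rw [hSS, hTT]; module⟩
  rw [Matrix.conjTranspose_mul, Matrix.mul_assoc, ← Matrix.mul_assoc gᴴ, hgg', Matrix.one_mul, hS]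

theorem exists_isUnit_mul_eq {S' : Matrix (Fin n) (Fin m) ℂ} (hS : Sᴴ * S = 1)
    (hS' : S'ᴴ * S' = 1) (h : S * Sᴴ = S' * S'ᴴ) :
    ∃ U : Matrix (Fin m) (Fin m) ℂ, IsUnit U ∧ S' = S * U := by
  refine ⟨Sᴴ * S', IsUnit.of_mul_eq_one (S'ᴴ * S) ?_, ?_⟩
  · rw [Matrix.mul_assoc, ← Matrix.mul_assoc S', ← h, Matrix.mul_assoc, hS, Matrix.mul_one, hS]
  · rw [← Matrix.mul_assoc, h, Matrix.mul_assoc, hS', Matrix.mul_one]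

end Eigenbasis

section InvertiblePaths

variable {R : Type*} [Ring R] [Algebra ℂ R] {x : R}

theorem countable_setOf_not_isUnit_one_sub_smul_add (hx : (spectrum ℂ x).Countable) :
    {z : ℂ | ¬IsUnit ((1 - z) • (1 : R) + z • x)}.Countable := by
  refine (hx.image fun w => (1 - w)⁻¹).mono fun z hz => ?_
  have hz₀ : z ≠ 0 := by
    rintro rfl
    simp at hz
  refine ⟨1 - z⁻¹, fun hw => hz ?_, by simp⟩
  rw [spectrum.mem_resolventSet_iff] at hw
  convert hw.smul (Units.mk0 (-z) (neg_ne_zero.2 hz₀)) using 1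
  rw [Units.smul_mk0, smul_sub, Algebra.algebraMap_eq_smul_one, smul_smul, neg_smul, sub_neg_eq_add]
  congr 2
  field_simp
  ring

theorem joinedIn_isUnit_one_of_countable_spectrum [TopologicalSpace R] [ContinuousAdd R]
    [ContinuousSMul ℂ R] (hx : (spectrum ℂ x).Countable) (hu : IsUnit x) :
    JoinedIn {y : R | IsUnit y} 1 x := by
  set line : ℂ → R := fun z => (1 - z) • (1 : R) + z • x
  have hconn : IsPathConnected {z | ¬IsUnit (line z)}ᶜ :=
    (countable_setOf_not_isUnit_one_sub_smul_add hx).isPathConnected_compl_of_one_lt_rank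
      (by rw [Complex.rank_real_complex]; exact Cardinal.one_lt_two)
  have hjoin := (hconn.joinedIn 0 (by simp [line]) 1 (by simpa [line] using hu)).map
    (f := line) (by fun_prop)
  rw [show line 0 = 1 by simp [line], show line 1 = x by simp [line]] at hjoin
  refine hjoin.mono ?_
  rintro _ ⟨z, hz, rfl⟩
  exact not_not.1 hz

end InvertiblePaths

section KZeroClasses

attribute [local instance] CStarAlgebra.spectralOrder CStarAlgebra.spectralOrderedRing

variable {E : Type*} [CStarAlgebra E] {n : ℕ} {h h₀ h₁ : CStarMatrix (Fin n) (Fin n) E}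

theorem K0Unital.mk_eq_of_joinedIn {p q : CStarMatrix (Fin n) (Fin n) E}
    (hp : IsStarProjection p) (hq : IsStarProjection q)
    (h : JoinedIn {x : CStarMatrix (Fin n) (Fin n) E | IsStarProjection x} p q) :
    K0Unital.mk p hp = K0Unital.mk q hq :=
  QuotientAddGroup.eq_iff_sub_mem.2
    (AddSubgroup.subset_closure (K0Rel.homotopy ⟨p, hp⟩ ⟨q, hq⟩ h))

theorem isStarProjection_matPosProj (hu : IsUnit h) : IsStarProjection (matPosProj h) :=
  isStarProjection_posProj hu

theorem joinedIn_matPosProj (h : JoinedIn {h | IsSelfAdjoint h ∧ IsUnit h} h₀ h₁) :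
    JoinedIn {p | IsStarProjection p} (matPosProj h₀) (matPosProj h₁) := by
  refine (h.map_continuousOn continuousOn_posProj).mono ?_
  rintro _ ⟨x, hx, rfl⟩
  exact isStarProjection_posProj hx.2

theorem existsUnique_isK0UnitalClass (hsa : IsSelfAdjoint h) (hu : IsUnit h) :
    ∃! κ : K0Unital E, IsK0UnitalClass h κ :=
  ⟨_, ⟨hsa, hu, isStarProjection_matPosProj hu, rfl⟩, fun _ hκ => hκ.2.2.choose_spec⟩

theorem IsK0UnitalClass.of_joinedIn (h : JoinedIn {h | IsSelfAdjoint h ∧ IsUnit h} h₀ h₁)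
    {κ : K0Unital E} (hκ : IsK0UnitalClass h₀ κ) : IsK0UnitalClass h₁ κ := by
  obtain ⟨-, -, hp, rfl⟩ := hκ
  obtain ⟨hsa, hu⟩ := h.target_mem
  exact ⟨hsa, hu, isStarProjection_matPosProj hu,
    K0Unital.mk_eq_of_joinedIn _ _ (joinedIn_matPosProj h)⟩

theorem K0Unital.map_mk {F : Type*} [CStarAlgebra F] (φ : E →⋆ₐ[ℂ] F)
    {p : CStarMatrix (Fin n) (Fin n) E} (hp : IsStarProjection p) :
    K0Unital.map φ (K0Unital.mk p hp) = K0Unital.mk (p.map φ) (map_isStarProjection φ hp) := rfl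

end KZeroClasses

section NonUnital

attribute [local instance] CStarAlgebra.spectralOrder CStarAlgebra.spectralOrderedRing

variable {A : Type*} [NonUnitalCStarAlgebra A] {n : ℕ}
  {h h₀ h₁ p q : CStarMatrix (Fin n) (Fin n) (Unitization ℂ A)}

theorem scalarPart_eq_map (h : CStarMatrix (Fin n) (Fin n) (Unitization ℂ A)) :
    scalarPart h = h.map ((StarAlgHom.ofId ℂ (Unitization ℂ A)).comp (scalarHom A)) := rfl

theorem isStarProjection_scalarPart (hp : IsStarProjection p) :
    IsStarProjection (scalarPart p) := by
  rw [scalarPart_eq_map]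
  exact map_isStarProjection _ hp

theorem joinedIn_scalarPart (h : JoinedIn {p | IsStarProjection p} p q) :
    JoinedIn {p | IsStarProjection p} (scalarPart p) (scalarPart q) := by
  refine (h.map (continuous_map
    ((StarAlgHom.ofId ℂ (Unitization ℂ A)).comp (scalarHom A)) n)).mono ?_
  rintro _ ⟨x, hx, rfl⟩
  exact isStarProjection_scalarPart hx

theorem mk_sub_mk_scalarPart_mem_ker (hp : IsStarProjection p) :
    K0Unital.mk p hp - K0Unital.mk (scalarPart p) (isStarProjection_scalarPart hp) ∈
      (K0Unital.map (scalarHom A)).ker := by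
  rw [AddMonoidHom.mem_ker, map_sub, sub_eq_zero, K0Unital.map_mk, K0Unital.map_mk]
  rfl

theorem existsUnique_isK0Class (hsa : IsSelfAdjoint h) (hu : IsUnit h) :
    ∃! κ : K0 A, IsK0Class h κ :=
  ⟨⟨_, mk_sub_mk_scalarPart_mem_ker (isStarProjection_matPosProj hu)⟩,
    ⟨hsa, hu, isStarProjection_matPosProj hu,
      isStarProjection_scalarPart (isStarProjection_matPosProj hu), rfl⟩,
    fun _ hκ => Subtype.ext hκ.2.2.choose_spec.choose_spec⟩

theorem IsK0Class.of_joinedIn (h : JoinedIn {h | IsSelfAdjoint h ∧ IsUnit h} h₀ h₁) {κ : K0 A}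
    (hκ : IsK0Class h₀ κ) : IsK0Class h₁ κ := by
  obtain ⟨-, -, hp, hs, hκ⟩ := hκ
  obtain ⟨hsa, hu⟩ := h.target_mem
  have hp₁ := isStarProjection_matPosProj hu
  have hproj := joinedIn_matPosProj h
  refine ⟨hsa, hu, hp₁, isStarProjection_scalarPart hp₁, ?_⟩
  rw [hκ, K0Unital.mk_eq_of_joinedIn hp hp₁ hproj,
    K0Unital.mk_eq_of_joinedIn hs (isStarProjection_scalarPart hp₁) (joinedIn_scalarPart hproj)]

end NonUnital

section KOneClasses

attribute [local instance] CStarAlgebra.spectralOrder CStarAlgebra.spectralOrderedRing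

variable {E : Type*} [CStarAlgebra E] {m n : ℕ}

theorem K1Unital.mk_eq_of_joinedIn {x y : CStarMatrix (Fin n) (Fin n) E} (hx : IsUnit x)
    (hy : IsUnit y) (h : JoinedIn {x : CStarMatrix (Fin n) (Fin n) E | IsUnit x} x y) :
    K1Unital.mk x hx = K1Unital.mk y hy :=
  QuotientAddGroup.eq_iff_sub_mem.2
    (AddSubgroup.subset_closure (K1Rel.homotopy ⟨x, hx⟩ ⟨y, hy⟩ h))

theorem scal_mul_scal {l : ℕ} (M : Matrix (Fin n) (Fin m) ℂ) (N : Matrix (Fin m) (Fin l) ℂ) :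
    scal E M * scal E N = scal E (M * N) :=
  (Matrix.map_mul (f := algebraMap ℂ E)).symm

theorem scal_one : scal E (1 : Matrix (Fin n) (Fin n) ℂ) = 1 := by
  rw [scal_eq_tens, tens_one_one]

theorem scal_add (M N : Matrix (Fin n) (Fin m) ℂ) : scal E (M + N) = scal E M + scal E N :=
  Matrix.map_add _ (map_add (algebraMap ℂ E)) M N

theorem scal_sub (M N : Matrix (Fin n) (Fin m) ℂ) : scal E (M - N) = scal E M - scal E N :=
  Matrix.map_sub _ (map_sub (algebraMap ℂ E)) M N

theorem cstarMatrix_mul_assoc {k l : ℕ} (a : CStarMatrix (Fin n) (Fin m) E)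
    (b : CStarMatrix (Fin m) (Fin l) E) (c : CStarMatrix (Fin l) (Fin k) E) :
    a * b * c = a * (b * c) :=
  Matrix.mul_assoc (α := E) a b c

theorem isUnit_scal {M : Matrix (Fin n) (Fin n) ℂ} (hM : IsUnit M) : IsUnit (scal E M) := by
  obtain ⟨u, rfl⟩ := hM
  exact ⟨⟨scal E u, scal E ↑u⁻¹, by rw [scal_mul_scal, Units.mul_inv, scal_one],
    by rw [scal_mul_scal, Units.inv_mul, scal_one]⟩, rfl⟩

theorem continuous_scal : Continuous (scal E : Matrix (Fin n) (Fin m) ℂ → _) :=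
  continuous_id.matrix_map (continuous_algebraMap ℂ E)

theorem joinedIn_isUnit_scal_one {M : Matrix (Fin n) (Fin n) ℂ} (hM : IsUnit M) :
    JoinedIn {x : CStarMatrix (Fin n) (Fin n) E | IsUnit x} 1 (scal E M) := by
  rw [← scal_one]
  refine ((joinedIn_isUnit_one_of_countable_spectrum
    (Matrix.finite_spectrum M).countable hM).map continuous_scal).mono ?_
  rintro _ ⟨N, hN, rfl⟩
  exact isUnit_scal hN

theorem joinedIn_mul_mul {R : Type*} [Monoid R] [TopologicalSpace R] [ContinuousMul R]
    {x u v : R} (hx : IsUnit x) (hu : JoinedIn {y : R | IsUnit y} 1 u)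
    (hv : JoinedIn {y : R | IsUnit y} 1 v) : JoinedIn {y : R | IsUnit y} x (u * x * v) := by
  have hpath := (hu.mul (JoinedIn.refl (F := {y : R | IsUnit y}) hx)).mul hv
  rw [one_mul, mul_one] at hpath
  refine hpath.mono ?_
  rintro _ ⟨_, ⟨a, ha, b, hb, rfl⟩, c, hc, rfl⟩
  exact (ha.mul hb).mul hc

variable {Γ : Matrix (Fin n) (Fin n) ℂ} {S T : Matrix (Fin n) (Fin m) ℂ}
  {h h₀ h₁ : CStarMatrix (Fin n) (Fin n) E}

theorem IsEigenbasis.scal_mul_eq_mul_scal (hST : IsEigenbasis Γ S T)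
    (ha : scal E Γ * h = -(h * scal E Γ)) :
    scal E (S * Sᴴ) * h = h * scal E (T * Tᴴ) := by
  have hadd : scal E (S * Sᴴ) + scal E (T * Tᴴ) = 1 := by
    rw [← scal_add, hST.add_eq_one, scal_one]
  have hsub : scal E (S * Sᴴ) - scal E (T * Tᴴ) = scal E Γ := by rw [← scal_sub, hST.sub_eq]
  refine smul_right_injective _ (two_ne_zero : (2 : ℂ) ≠ 0) ?_
  calc (2 : ℂ) • (scal E (S * Sᴴ) * h)
      = (scal E (S * Sᴴ) + scal E (T * Tᴴ)) * h +
          (scal E (S * Sᴴ) - scal E (T * Tᴴ)) * h := by rw [two_smul]; noncomm_ring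
    _ = h * (scal E (S * Sᴴ) + scal E (T * Tᴴ)) -
          h * (scal E (S * Sᴴ) - scal E (T * Tᴴ)) := by
        rw [hadd, hsub, ha, one_mul, mul_one, sub_eq_add_neg]
    _ = (2 : ℂ) • (h * scal E (T * Tᴴ)) := by rw [two_smul]; noncomm_ring

theorem IsEigenbasis.isUnit_scal_mul_mul_scal (hST : IsEigenbasis Γ S T) (hu : IsUnit h)
    (ha : scal E Γ * h = -(h * scal E Γ)) : IsUnit (scal E Sᴴ * h * scal E T) := by
  obtain ⟨w, hwv, hvw⟩ := isUnit_iff_exists.1 hu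
  have hcomm := hST.scal_mul_eq_mul_scal ha
  refine ⟨⟨_, scal E Tᴴ * w * scal E S, ?_, ?_⟩, rfl⟩
  · calc scal E Sᴴ * h * scal E T * (scal E Tᴴ * w * scal E S)
        = scal E Sᴴ * ((h * (scal E T * scal E Tᴴ)) * w) * scal E S := by
          simp only [cstarMatrix_mul_assoc]
      _ = scal E Sᴴ * scal E (S * Sᴴ) * scal E S := by
          rw [scal_mul_scal, ← hcomm, mul_assoc, hwv, mul_one]
      _ = 1 := by
          rw [scal_mul_scal, scal_mul_scal, ← Matrix.mul_assoc, hST.isometry_left, Matrix.one_mul,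
            hST.isometry_left, scal_one]
  · calc scal E Tᴴ * w * scal E S * (scal E Sᴴ * h * scal E T)
        = scal E Tᴴ * (w * ((scal E S * scal E Sᴴ) * h)) * scal E T := by
          simp only [cstarMatrix_mul_assoc]
      _ = scal E Tᴴ * scal E (T * Tᴴ) * scal E T := by
          rw [scal_mul_scal, hcomm, ← mul_assoc, hvw, one_mul]
      _ = 1 := by
          rw [scal_mul_scal, scal_mul_scal, ← Matrix.mul_assoc, hST.isometry_right, Matrix.one_mul,
            hST.isometry_right, scal_one]

theorem isK1Class_iff {κ : K1Unital E} : IsK1Class Γ h κ ↔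
    IsSelfAdjoint h ∧ IsUnit h ∧ scal E Γ * h = -(h * scal E Γ) ∧
      ∃ (m : ℕ) (S T : Matrix (Fin n) (Fin m) ℂ) (hx : IsUnit (scal E Sᴴ * h * scal E T)),
        IsEigenbasis Γ S T ∧ κ = K1Unital.mk (scal E Sᴴ * h * scal E T) hx :=
  ⟨fun ⟨hsa, hu, ha, m, S, T, hx, hS, hT, hadd, hsub, hκ⟩ =>
      ⟨hsa, hu, ha, m, S, T, hx, ⟨hS, hT, hadd, hsub⟩, hκ⟩,
    fun ⟨hsa, hu, ha, m, S, T, hx, hST, hκ⟩ =>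
      ⟨hsa, hu, ha, m, S, T, hx, hST.1, hST.2, hST.3, hST.4, hκ⟩⟩

theorem IsEigenbasis.mk_scal_mul_mul_scal_eq {S' T' : Matrix (Fin n) (Fin m) ℂ}
    (hST : IsEigenbasis Γ S T) (hST' : IsEigenbasis Γ S' T')
    (hx : IsUnit (scal E Sᴴ * h * scal E T)) (hx' : IsUnit (scal E S'ᴴ * h * scal E T')) :
    K1Unital.mk _ hx = K1Unital.mk _ hx' := by
  obtain ⟨U, hU, rfl⟩ := exists_isUnit_mul_eq hST.isometry_left hST'.isometry_left
    (hST.left_mul_conjTranspose.trans hST'.left_mul_conjTranspose.symm)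
  obtain ⟨V, hV, rfl⟩ := exists_isUnit_mul_eq hST.isometry_right hST'.isometry_right
    (hST.right_mul_conjTranspose.trans hST'.right_mul_conjTranspose.symm)
  have hchange : scal E (S * U)ᴴ * h * scal E (T * V) =
      scal E Uᴴ * (scal E Sᴴ * h * scal E T) * scal E V := by
    simp only [Matrix.conjTranspose_mul, ← scal_mul_scal, cstarMatrix_mul_assoc]
  apply K1Unital.mk_eq_of_joinedIn
  rw [hchange]
  exact joinedIn_mul_mul hx (joinedIn_isUnit_scal_one hU.star) (joinedIn_isUnit_scal_one hV)

theorem IsEigenbasis.existsUnique_isK1Class (hST : IsEigenbasis Γ S T) (hsa : IsSelfAdjoint h)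
    (hu : IsUnit h) (ha : scal E Γ * h = -(h * scal E Γ)) :
    ∃! κ : K1Unital E, IsK1Class Γ h κ := by
  have hx := hST.isUnit_scal_mul_mul_scal hu ha
  refine ⟨K1Unital.mk _ hx, isK1Class_iff.2 ⟨hsa, hu, ha, m, S, T, hx, hST, rfl⟩, fun κ hκ => ?_⟩
  obtain ⟨-, -, -, m', S', T', hx', hST', rfl⟩ := isK1Class_iff.1 hκ
  have hdim := hST.add_self_eq
  have hdim' := hST'.add_self_eq
  obtain rfl : m' = m := by lia
  exact hST'.mk_scal_mul_mul_scal_eq hST hx' hx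

theorem IsK1Class.of_joinedIn
    (h : JoinedIn {h | IsSelfAdjoint h ∧ IsUnit h ∧ scal E Γ * h = -(h * scal E Γ)} h₀ h₁)
    {κ : K1Unital E} (hκ : IsK1Class Γ h₀ κ) : IsK1Class Γ h₁ κ := by
  obtain ⟨-, -, -, m, S, T, hx₀, hST, rfl⟩ := isK1Class_iff.1 hκ
  obtain ⟨hsa, hu, ha⟩ := h.target_mem
  have hx₁ := hST.isUnit_scal_mul_mul_scal hu ha
  refine isK1Class_iff.2 ⟨hsa, hu, ha, m, S, T, hx₁, hST, ?_⟩
  refine K1Unital.mk_eq_of_joinedIn _ _ ((h.map (f := fun h => scal E Sᴴ * h * scal E T)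
    ((continuous_const.matrix_mul continuous_id).matrix_mul continuous_const)).mono ?_)
  rintro _ ⟨h, hh, rfl⟩
  exact hST.isUnit_scal_mul_mul_scal hh.2.1 hh.2.2

end KOneClasses

section Classes

variable {E : Type*} [CStarAlgebra E] {d k n : ℕ} {δ : ℝ}

theorem IsFurtherGenerator.existsUnique_isK1Class
    {γ : Fin (k + 1) → Matrix (Fin n) (Fin n) ℂ} {Γ : Matrix (Fin n) (Fin n) ℂ}
    {h : CStarMatrix (Fin n) (Fin n) E} (hΓ : IsFurtherGenerator γ Γ) (hγ : IsClifford γ)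
    (hsa : IsSelfAdjoint h) (hu : IsUnit h) (ha : scal E Γ * h = -(h * scal E Γ)) :
    ∃! κ : K1Unital E, IsK1Class Γ h κ := by
  obtain ⟨m, S, T, hST⟩ := exists_isEigenbasis_of_anticommute hΓ.isHermitian hΓ.sq_eq_one
    (Matrix.mem_unitaryGroup_iff'.2 (hγ.conjTranspose_mul_self (Fin.last k)))
    (hΓ.anticommute (Fin.last k))
  exact hST.existsUnique_isK1Class hsa hu ha

variable {I : Finset (Fin d)} {γ : Fin (I.card + 1) → Matrix (Fin n) (Fin n) ℂ}
  {Γ : Matrix (Fin n) (Fin n) ℂ} {T : Fin (d + 1) → E}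

theorem IsFuzzyTorus.existsUnique_isK1Class_gOp_one {T : Fin d → E} (hT : IsFuzzyTorus δ T)
    (hδ : 100 * (d + 1) ^ 3 * δ ≤ 1) (hγ : IsClifford γ) (hΓ : IsFurtherGenerator γ Γ) :
    ∃! κ : K1Unital E, IsK1Class Γ (gOp 1 T I γ) κ :=
  hΓ.existsUnique_isK1Class hγ (isSelfAdjoint_gOp_one T hγ.isHermitian)
    (hT.isUnit_gOp_one hδ hγ) (scal_mul_gOp_one T hΓ.anticommute)

theorem IsGradedFuzzyTorus.joinedIn_isSelfAdjoint_isUnit (hT : IsGradedFuzzyTorus δ T)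
    (hδ : 100 * (d + 1) ^ 3 * δ ≤ 1) (hγ : IsClifford γ) :
    JoinedIn {h | IsSelfAdjoint h ∧ IsUnit h} (gHatOp T I γ) (gRestrictedOp T I γ) :=
  (hT.joinedIn_gHatOp_gRestrictedOp hδ hγ).mono fun _ hh => ⟨hh.1, hh.2.1⟩

theorem IsGradedFuzzyTorus.joinedIn_anticommute (hT : IsGradedFuzzyTorus δ T)
    (hδ : 100 * (d + 1) ^ 3 * δ ≤ 1) (hγ : IsClifford γ) (hΓ : IsFurtherGenerator γ Γ) :
    JoinedIn {h | IsSelfAdjoint h ∧ IsUnit h ∧ scal E Γ * h = -(h * scal E Γ)}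
      (gHatOp T I γ) (gRestrictedOp T I γ) :=
  (hT.joinedIn_gHatOp_gRestrictedOp hδ hγ).mono fun _ hh =>
    ⟨hh.1, hh.2.1, hh.2.2 Γ hΓ.anticommute⟩

end Classes

end FuzzyTorus

end

open FuzzyTorus in
theorem mainTheorem11_general {d n : ℕ} {δ : ℝ} (hδ : 100 * (d + 1) ^ 3 * δ ≤ 1)
    {I : Finset (Fin d)} {γ : Fin (I.card + 1) → Matrix (Fin n) (Fin n) ℂ}
    (hγ : IsClifford γ) :
    (Odd I.card → ∃ Γ, IsFurtherGenerator γ Γ) ∧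
      (∀ (A : Type u) [CStarAlgebra A],
        (∀ T : Fin d → A, IsFuzzyTorus δ T →
          (∃! κ : K0Unital A, IsK0UnitalClass (gOp 1 T I γ) κ) ∧
          ∀ Γ, IsFurtherGenerator γ Γ → ∃! κ : K1Unital A, IsK1Class Γ (gOp 1 T I γ) κ) ∧
        ∀ T : Fin (d + 1) → A, IsGradedFuzzyTorus δ T →
          (IsStarProjection (gradingProj T) ∧
            IsFuzzyTorusIn (gradingProj T) (6 * δ) (restrictedTorus T)) ∧
          ((∃! κ : K0Unital A, IsK0UnitalClass (gHatOp T I γ) κ) ∧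
            ∀ κ : K0Unital A, IsK0UnitalClass (gHatOp T I γ) κ →
              IsK0UnitalClass (gRestrictedOp T I γ) κ) ∧
          ∀ Γ, IsFurtherGenerator γ Γ →
            (∃! κ : K1Unital A, IsK1Class Γ (gHatOp T I γ) κ) ∧
            ∀ κ : K1Unital A, IsK1Class Γ (gHatOp T I γ) κ →
              IsK1Class Γ (gRestrictedOp T I γ) κ) ∧
      ∀ (A : Type u) [NonUnitalCStarAlgebra A],
        (∀ T : Fin d → Unitization ℂ A, IsFuzzyTorus δ T →
          ∃! κ : K0 A, IsK0Class (gOp 1 T I γ) κ) ∧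
        ∀ T : Fin (d + 1) → Unitization ℂ A, IsGradedFuzzyTorus δ T →
          (∃! κ : K0 A, IsK0Class (gHatOp T I γ) κ) ∧
          ∀ κ : K0 A, IsK0Class (gHatOp T I γ) κ → IsK0Class (gRestrictedOp T I γ) κ := by
  refine ⟨fun hI => hγ.exists_isFurtherGenerator hI.add_one,
    fun A _ => ⟨fun T hT => ⟨?_, fun Γ hΓ => hT.existsUnique_isK1Class_gOp_one hδ hγ hΓ⟩,
      fun T hT => ⟨⟨hT.isStarProjection_gradingProj,
        hT.isFuzzyTorusIn_restrictedTorus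
          (by simpa using card_add_one_pow_mul_le hT.2.width_nonneg hδ ∅)⟩, ?_, fun Γ hΓ => ?_⟩⟩,
    fun A _ => ⟨fun T hT => ?_, fun T hT => ?_⟩⟩
  · exact existsUnique_isK0UnitalClass (isSelfAdjoint_gOp_one T hγ.isHermitian)
      (hT.isUnit_gOp_one hδ hγ)
  · have hpath := hT.joinedIn_isSelfAdjoint_isUnit (I := I) hδ hγ
    exact ⟨existsUnique_isK0UnitalClass hpath.source_mem.1 hpath.source_mem.2,
      fun _ => .of_joinedIn hpath⟩
  · have hpath := hT.joinedIn_anticommute hδ hγ hΓ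
    obtain ⟨hsa, hu, ha⟩ := hpath.source_mem
    exact ⟨hΓ.existsUnique_isK1Class hγ hsa hu ha, fun _ => .of_joinedIn hpath⟩
  · exact existsUnique_isK0Class (isSelfAdjoint_gOp_one T hγ.isHermitian)
      (hT.isUnit_gOp_one hδ hγ)
  · have hpath := hT.joinedIn_isSelfAdjoint_isUnit (I := I) hδ hγ
    exact ⟨existsUnique_isK0Class hpath.source_mem.1 hpath.source_mem.2,
      fun _ => .of_joinedIn hpath⟩

theorem mainTheorem11 (d : ℕ) :
    ∃ δ₀ : ℝ, 0 < δ₀ ∧ ∀ δ : ℝ, δ ≤ δ₀ →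
      -- unital C⋆-algebras `A`, tori in `A`
      (∀ (A : Type u) [CStarAlgebra A] (I : Finset (Fin d)) (n : ℕ)
          (γ : Fin (I.card + 1) → Matrix (Fin n) (Fin n) ℂ),
        FuzzyTorus.IsIrreducibleClifford γ →
        (∀ T : Fin d → A, FuzzyTorus.IsFuzzyTorus δ T →
          (Even I.card →
            ∃! κ : FuzzyTorus.K0Unital A,
              FuzzyTorus.IsK0UnitalClass (FuzzyTorus.gOp 1 T I γ) κ) ∧
          (Odd I.card →
            (∃ Γ, FuzzyTorus.IsFurtherGenerator γ Γ) ∧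
            ∀ Γ, FuzzyTorus.IsFurtherGenerator γ Γ →
              ∃! κ : FuzzyTorus.K1Unital A,
                FuzzyTorus.IsK1Class Γ (FuzzyTorus.gOp 1 T I γ) κ)) ∧
        (∀ T : Fin (d + 1) → A, FuzzyTorus.IsGradedFuzzyTorus δ T →
          (IsStarProjection (FuzzyTorus.gradingProj T) ∧
            FuzzyTorus.IsFuzzyTorusIn (FuzzyTorus.gradingProj T) (6 * δ)
              (FuzzyTorus.restrictedTorus T)) ∧
          (Even I.card →
            (∃! κ : FuzzyTorus.K0Unital A,
              FuzzyTorus.IsK0UnitalClass (FuzzyTorus.gHatOp T I γ) κ) ∧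
            ∀ κ : FuzzyTorus.K0Unital A,
              FuzzyTorus.IsK0UnitalClass (FuzzyTorus.gHatOp T I γ) κ →
              FuzzyTorus.IsK0UnitalClass (FuzzyTorus.gRestrictedOp T I γ) κ) ∧
          (Odd I.card →
            (∃ Γ, FuzzyTorus.IsFurtherGenerator γ Γ) ∧
            ∀ Γ, FuzzyTorus.IsFurtherGenerator γ Γ →
              (∃! κ : FuzzyTorus.K1Unital A,
                FuzzyTorus.IsK1Class Γ (FuzzyTorus.gHatOp T I γ) κ) ∧
              ∀ κ : FuzzyTorus.K1Unital A,
                FuzzyTorus.IsK1Class Γ (FuzzyTorus.gHatOp T I γ) κ →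
                FuzzyTorus.IsK1Class Γ (FuzzyTorus.gRestrictedOp T I γ) κ))) ∧
      -- arbitrary C⋆-algebras `A`, tori in the unitization `A^∼ = ℂ ⊕ A`
      (∀ (A : Type u) [NonUnitalCStarAlgebra A] (I : Finset (Fin d)) (n : ℕ)
          (γ : Fin (I.card + 1) → Matrix (Fin n) (Fin n) ℂ),
        FuzzyTorus.IsIrreducibleClifford γ →
        (∀ T : Fin d → Unitization ℂ A, FuzzyTorus.IsFuzzyTorus δ T →
          (Even I.card →
            ∃! κ : FuzzyTorus.K0 A, FuzzyTorus.IsK0Class (FuzzyTorus.gOp 1 T I γ) κ) ∧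
          (Odd I.card →
            (∃ Γ, FuzzyTorus.IsFurtherGenerator γ Γ) ∧
            ∀ Γ, FuzzyTorus.IsFurtherGenerator γ Γ →
              ∃! κ : FuzzyTorus.K1 A,
                FuzzyTorus.IsK1Class Γ (FuzzyTorus.gOp 1 T I γ) κ)) ∧
        (∀ T : Fin (d + 1) → Unitization ℂ A, FuzzyTorus.IsGradedFuzzyTorus δ T →
          (IsStarProjection (FuzzyTorus.gradingProj T) ∧
            FuzzyTorus.IsFuzzyTorusIn (FuzzyTorus.gradingProj T) (6 * δ)
              (FuzzyTorus.restrictedTorus T)) ∧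
          (Even I.card →
            (∃! κ : FuzzyTorus.K0 A, FuzzyTorus.IsK0Class (FuzzyTorus.gHatOp T I γ) κ) ∧
            ∀ κ : FuzzyTorus.K0 A,
              FuzzyTorus.IsK0Class (FuzzyTorus.gHatOp T I γ) κ →
              FuzzyTorus.IsK0Class (FuzzyTorus.gRestrictedOp T I γ) κ) ∧
          (Odd I.card →
            (∃ Γ, FuzzyTorus.IsFurtherGenerator γ Γ) ∧
            ∀ Γ, FuzzyTorus.IsFurtherGenerator γ Γ →
              (∃! κ : FuzzyTorus.K1 A,
                FuzzyTorus.IsK1Class Γ (FuzzyTorus.gHatOp T I γ) κ) ∧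
              ∀ κ : FuzzyTorus.K1 A,
                FuzzyTorus.IsK1Class Γ (FuzzyTorus.gHatOp T I γ) κ →
                FuzzyTorus.IsK1Class Γ (FuzzyTorus.gRestrictedOp T I γ) κ))) := by
  refine ⟨1 / (100 * (d + 1) ^ 3), by positivity, fun δ hδ => ?_⟩
  rw [le_div_iff₀' (by positivity)] at hδ
  refine ⟨fun A _ I n γ hγ => ?_, fun A _ I n γ hγ => ?_⟩
  · obtain ⟨hΓ, hA, -⟩ := mainTheorem11_general hδ hγ.isClifford
    obtain ⟨hG, hGhat⟩ := hA A
    exact ⟨fun T hT => ⟨fun _ => (hG T hT).1, fun hI => ⟨hΓ hI, (hG T hT).2⟩⟩,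
      fun T hT => ⟨(hGhat T hT).1, fun _ => (hGhat T hT).2.1,
        fun hI => ⟨hΓ hI, (hGhat T hT).2.2⟩⟩⟩
  · obtain ⟨hΓ, hA₁, hA₀⟩ := mainTheorem11_general hδ hγ.isClifford
    obtain ⟨hG₁, hGhat₁⟩ := hA₁ (Unitization ℂ A)
    obtain ⟨hG₀, hGhat₀⟩ := hA₀ A
    exact ⟨fun T hT => ⟨fun _ => hG₀ T hT, fun hI => ⟨hΓ hI, (hG₁ T hT).2⟩⟩,
      fun T hT => ⟨(hGhat₁ T hT).1, fun _ => hGhat₀ T hT,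
        fun hI => ⟨hΓ hI, (hGhat₁ T hT).2.2⟩⟩⟩
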